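/- Let $n \ge 0$ be an integer, let $\mathcal{O}$ be the ring of germs at $0\in\mathbb{C}^n$ of holomorphic functions, and let $K=\operatorname{Frac}\mathcal{O}$ be the field of germs of meromorphic functions, with its commuting derivations $\partial/\partial z_1,\dots,\partial/\partial z_n$. Let $\omega=\sum_i w_i\,dz_i$ be a nonzero germ at $0$ of holomorphic $1$-form with $\omega\wedge d\omega=0$; it defines a germ $\mathcal{F}$ of (possibly singular) holomorphic foliation of codimension one. A differential extension of $K$ is a field $L\supseteq K$ with $n$ commuting derivations $D_1,\dots,D_n$ extending $\partial/\partial z_1,\dots,\partial/\partial z_n$; for $x\in L$ put $dx=\sum_i D_i(x)\,dz_i$, and define $d$ and $\wedge$ on forms with coefficients in $L$ accordingly. The extension is of Darboux type (resp. Liouville type, Riccati type) if there is a finite sequence of differential fields $K=E_0\subseteq E_1\subseteq\dots\subseteq E_m=L$ such that each $E_{i+1}/E_i$ is either algebraic or of the form $E_{i+1}=E_i(G)$ with - Darboux: $dG=\gamma$, - Liouville: $dG=G\gamma_1+\gamma_0$, - Riccati: $dG=\frac{G^2}{2}\gamma_2+G\gamma_1+\gamma_0$, where $\gamma,\gamma_0,\gamma_1,\gamma_2$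 are $1$-forms with coefficients in $E_i$. The foliation $\mathcal{F}$ has a first integral of Darboux (resp. Liouville, Riccati) type if some extension $L$ of that type contains an $H$ with $dH\neq 0$ and $dH\wedge\omega=0$. A Godbillon–Vey sequence for $\omega$ is a sequence $\omega_0=\omega,\omega_1,\omega_2,\dots$ of germs of meromorphic $1$-forms with $$d\omega_m=\omega\wedge\omega_{m+1}+\sum_{k=1}^{m}\binom{m}{k}\,\omega_k\wedge\omega_{m-k+1}\qquad(m\ge 0).$$ For $\ell\ge 2$ it is of length $\ell$ if $\omega_i=0$ for all $i\ge\ell$. One says that $\omega$ has a Godbillon–Vey sequence of length one if there are $F\in K\setminus\{0\}$ and an integer $k\ge 1$ with $d(F^{1/k}\omega)=0$, where $F^{1/k}$ is a $k$-th root of $F$ in a differential extension of $K$. Then: 1. $\mathcal{F}$ has a first integral of Darboux type if and only if $\omega$ has a Godbillon–Vey sequence of length one; 2. $\mathcal{F}$ has a first integral of Liouville type if and only if $\omega$ has a Godbillon–Vey sequence of length two; 3. $\mathcal{F}$ has a first integral of Riccati type if and only if $\omega$ has a Godbillon–Vey sequence of length three. -/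

import Mathlib

open Filter Topology

noncomputable section

namespace GVFoliation

/-! ### Germs of holomorphic and of meromorphic functions at the origin of `ℂⁿ` -/

/-- The ring of germs at `0 ∈ ℂⁿ` of holomorphic functions. -/
def HolGerm (n : ℕ) : Subring (Germ (𝓝 (0 : Fin n → ℂ)) ℂ) where
  carrier := {g | ∃ f : (Fin n → ℂ) → ℂ, AnalyticAt ℂ f 0 ∧ (f : Germ (𝓝 (0 : Fin n → ℂ)) ℂ) = g}
  mul_mem' := by
    rintro _ _ ⟨f, hf, rfl⟩ ⟨g, hg, rfl⟩
    exact ⟨f * g, hf.mul hg, rfl⟩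
  one_mem' := ⟨fun _ => 1, analyticAt_const, rfl⟩
  add_mem' := by
    rintro _ _ ⟨f, hf, rfl⟩ ⟨g, hg, rfl⟩
    exact ⟨f + g, hf.add hg, rfl⟩
  zero_mem' := ⟨fun _ => 0, analyticAt_const, rfl⟩
  neg_mem' := by
    rintro _ ⟨f, hf, rfl⟩
    exact ⟨-f, hf.neg, rfl⟩

theorem analytic_germ_mul_eq_zero {n : ℕ} {f g : (Fin n → ℂ) → ℂ}
    (hf : AnalyticAt ℂ f 0) (hg : AnalyticAt ℂ g 0) (h : ∀ᶠ z in 𝓝 0, f z * g z = 0) :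
    (∀ᶠ z in 𝓝 0, f z = 0) ∨ (∀ᶠ z in 𝓝 0, g z = 0) := by
  obtain ⟨r, hr, H⟩ := Metric.eventually_nhds_iff_ball.1
    ((hf.eventually_analyticAt.and hg.eventually_analyticAt).and h)
  by_cases hz : ∀ z ∈ Metric.ball (0 : Fin n → ℂ) r, f z = 0
  · exact Or.inl (eventually_of_mem (Metric.ball_mem_nhds 0 hr) hz)
  · right
    push Not at hz
    obtain ⟨a, ha, hfa⟩ := hz
    have hga : g =ᶠ[𝓝 a] 0 := by
      have h1 : ∀ᶠ z in 𝓝 a, f z ≠ 0 := (H a ha).1.1.continuousAt.eventually_ne hfa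
      filter_upwards [h1, Metric.isOpen_ball.mem_nhds ha] with z hz1 hz2
      exact (mul_eq_zero.1 (H z hz2).2).resolve_left hz1
    have hG : AnalyticOnNhd ℂ g (Metric.ball 0 r) := fun z hz => (H z hz).1.2
    have hE := hG.eqOn_zero_of_preconnected_of_eventuallyEq_zero
      (convex_ball (0 : Fin n → ℂ) r).isPreconnected ha hga
    exact eventually_of_mem (Metric.ball_mem_nhds 0 hr) hE

instance instIsDomainHolGerm (n : ℕ) : IsDomain (HolGerm n) := by
  have : NoZeroDivisors (HolGerm n) := by
    refine ⟨?_⟩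
    rintro ⟨_, f, hf, rfl⟩ ⟨_, g, hg, rfl⟩ h
    have h' : ((f * g : (Fin n → ℂ) → ℂ) : Germ (𝓝 (0 : Fin n → ℂ)) ℂ) = ((0 : (Fin n → ℂ) → ℂ) : _) :=
      congrArg Subtype.val h
    rcases analytic_germ_mul_eq_zero hf hg (Germ.coe_eq.1 h') with h0 | h0
    · exact Or.inl (Subtype.ext (Germ.coe_eq.2 h0))
    · exact Or.inr (Subtype.ext (Germ.coe_eq.2 h0))
  exact NoZeroDivisors.to_isDomain _

/-- The partial derivative `∂/∂zᵢ` on germs of functions. -/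
def germPartial {n : ℕ} (i : Fin n) :
    Germ (𝓝 (0 : Fin n → ℂ)) ℂ → Germ (𝓝 (0 : Fin n → ℂ)) ℂ :=
  Germ.map' (fun f z => fderiv ℂ f z (Pi.single i 1)) (fun _ _ h => by
    filter_upwards [EventuallyEq.fderiv (𝕜 := ℂ) h] with z hz
    rw [hz])

theorem germPartial_mem {n : ℕ} (i : Fin n) {g : Germ (𝓝 (0 : Fin n → ℂ)) ℂ}
    (hg : g ∈ HolGerm n) : germPartial i g ∈ HolGerm n := by
  obtain ⟨f, hf, rfl⟩ := hg
  exact ⟨fun z => fderiv ℂ f z (Pi.single i 1),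
    ((ContinuousLinearMap.apply ℂ ℂ (Pi.single i 1 : Fin n → ℂ)).analyticAt _).comp hf.fderiv, rfl⟩

theorem germPartial_add {n : ℕ} (i : Fin n) {g h : Germ (𝓝 (0 : Fin n → ℂ)) ℂ}
    (hg : g ∈ HolGerm n) (hh : h ∈ HolGerm n) :
    germPartial i (g + h) = germPartial i g + germPartial i h := by
  obtain ⟨f, hf, rfl⟩ := hg
  obtain ⟨k, hk, rfl⟩ := hh
  refine Germ.coe_eq.2 ?_
  filter_upwards [hf.eventually_analyticAt, hk.eventually_analyticAt] with z h1 h2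
  change fderiv ℂ (f + k) z (Pi.single i 1) = _
  rw [fderiv_add h1.differentiableAt h2.differentiableAt]
  rfl

theorem germPartial_mul {n : ℕ} (i : Fin n) {g h : Germ (𝓝 (0 : Fin n → ℂ)) ℂ}
    (hg : g ∈ HolGerm n) (hh : h ∈ HolGerm n) :
    germPartial i (g * h) = g * germPartial i h + h * germPartial i g := by
  obtain ⟨f, hf, rfl⟩ := hg
  obtain ⟨k, hk, rfl⟩ := hh
  refine Germ.coe_eq.2 ?_
  filter_upwards [hf.eventually_analyticAt, hk.eventually_analyticAt] with z h1 h2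
  change fderiv ℂ (f * k) z (Pi.single i 1) = _
  rw [fderiv_mul h1.differentiableAt h2.differentiableAt]
  rfl

/-- The partial derivative `∂/∂zᵢ` on germs of holomorphic functions. -/
def holPartial {n : ℕ} (i : Fin n) : Derivation ℤ (HolGerm n) (HolGerm n) :=
  Derivation.mk' (AddMonoidHom.mk' (fun g : HolGerm n => (⟨germPartial i g, germPartial_mem i g.2⟩ : HolGerm n))
      (fun g h => Subtype.ext (germPartial_add i g.2 h.2))).toIntLinearMap
    (fun g h => Subtype.ext (germPartial_mul i g.2 h.2))

/-- The field of germs at `0 ∈ ℂⁿ` of meromorphic functions. -/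
def MerGerm (n : ℕ) : Type := FractionRing (HolGerm n)

instance instFieldMerGerm (n : ℕ) : Field (MerGerm n) :=
  inferInstanceAs (Field (FractionRing (HolGerm n)))

instance instAlgebraMerGerm (n : ℕ) : Algebra (HolGerm n) (MerGerm n) :=
  inferInstanceAs (Algebra (HolGerm n) (FractionRing (HolGerm n)))

instance instIsFractionRingMerGerm (n : ℕ) : IsFractionRing (HolGerm n) (MerGerm n) :=
  inferInstanceAs (IsFractionRing (HolGerm n) (FractionRing (HolGerm n)))

/-- The ring homomorphism `f ↦ f + ε ∂ᵢ f` to the dual numbers; its extension to the fraction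
field encodes the quotient rule. -/
def holDual {n : ℕ} (i : Fin n) : HolGerm n →+* TrivSqZeroExt (MerGerm n) (MerGerm n) where
  toFun f := TrivSqZeroExt.inl (algebraMap _ (MerGerm n) f) +
    TrivSqZeroExt.inr (algebraMap _ (MerGerm n) (holPartial i f))
  map_one' := by ext <;> simp
  map_zero' := by ext <;> simp
  map_add' f g := by ext <;> simp [-DualNumber.inr_eq_smul_eps]
  map_mul' f g := by ext <;> simp [-DualNumber.inr_eq_smul_eps, mul_comm]

theorem holDual_isUnit {n : ℕ} (i : Fin n) (s : nonZeroDivisors (HolGerm n)) :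
    IsUnit (holDual i s) := by
  rw [TrivSqZeroExt.isUnit_iff_isUnit_fst]
  simpa only [holDual, RingHom.coe_mk, MonoidHom.coe_mk, OneHom.coe_mk, TrivSqZeroExt.fst_add,
    TrivSqZeroExt.fst_inl, TrivSqZeroExt.fst_inr, add_zero] using IsLocalization.map_units (MerGerm n) s

/-- `f ↦ f + ε ∂ᵢ f` on germs of meromorphic functions. -/
def merDual {n : ℕ} (i : Fin n) : MerGerm n →+* TrivSqZeroExt (MerGerm n) (MerGerm n) :=
  IsLocalization.lift (M := nonZeroDivisors (HolGerm n)) (holDual_isUnit i)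

theorem merDual_fst {n : ℕ} (i : Fin n) (x : MerGerm n) : (merDual i x).fst = x := by
  have h : ((TrivSqZeroExt.fstHom (MerGerm n) (MerGerm n) (MerGerm n)).toRingHom.comp (merDual i)) =
      RingHom.id (MerGerm n) := by
    refine IsLocalization.ringHom_ext (nonZeroDivisors (HolGerm n)) ?_
    ext f
    simp [merDual, holDual]
  exact congrArg (fun φ : MerGerm n →+* MerGerm n => φ x) h

/-- The partial derivative `∂/∂zᵢ` on germs of meromorphic functions. -/
def merPartial {n : ℕ} (i : Fin n) : Derivation ℤ (MerGerm n) (MerGerm n) :=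
  Derivation.mk' (AddMonoidHom.mk' (fun x => (merDual i x).snd)
      (fun x y => by simp)).toIntLinearMap
    (fun x y => by simp [merDual_fst, mul_comm])

theorem merPartial_algebraMap {n : ℕ} (i : Fin n) (f : HolGerm n) :
    merPartial i (algebraMap (HolGerm n) (MerGerm n) f) =
      algebraMap (HolGerm n) (MerGerm n) (holPartial i f) := by
  simp [merPartial, merDual, holDual, -DualNumber.inr_eq_smul_eps]

/-! ### Differential forms in the coordinates `z₁, …, zₙ`

A 1-form `∑ᵢ αᵢ dzᵢ` with coefficients in a field `L` is its family of coefficients `Fin n → L`;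
a 2-form is its skew family of coefficients on the `dzᵢ ∧ dzⱼ`. The family `D` consists of the
derivations of `L` that play the role of the `∂/∂zᵢ`. -/

section Forms

variable {n : ℕ} {L : Type*} [Field L]

/-- The differential `dx` of an element `x`. -/
def dFun (D : Fin n → Derivation ℤ L L) (x : L) : Fin n → L := fun i => D i x

/-- The exterior derivative `dα` of a 1-form. -/
def dForm (D : Fin n → Derivation ℤ L L) (α : Fin n → L) : Fin n → Fin n → L :=
  fun i j => D i (α j) - D j (α i)

/-- The exterior product `α ∧ β` of two 1-forms. -/
def wedge (α β : Fin n → L) : Fin n → Fin n → L :=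
  fun i j => α i * β j - α j * β i

/-- The exterior product `α ∧ θ` of a 1-form and a 2-form. -/
def wedge₂ (α : Fin n → L) (θ : Fin n → Fin n → L) : Fin n → Fin n → Fin n → L :=
  fun i j k => α i * θ j k - α j * θ i k + α k * θ i j

end Forms

/-- The meromorphic 1-form given by a holomorphic one. -/
def toMer {n : ℕ} (ω : Fin n → HolGerm n) : Fin n → MerGerm n :=
  fun i => algebraMap (HolGerm n) (MerGerm n) (ω i)

/-- Frobenius integrability `ω ∧ dω = 0` of a germ of holomorphic 1-form. -/
def IsIntegrable {n : ℕ} (ω : Fin n → HolGerm n) : Prop :=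
  wedge₂ (toMer ω) (dForm merPartial (toMer ω)) = 0

/-! ### Godbillon–Vey sequences -/

/-- A Godbillon–Vey sequence for `ω`: meromorphic 1-forms `Ω 0 = ω, Ω 1, Ω 2, …` with
`d(Ω m) = ω ∧ Ω (m+1) + ∑_{k=1}^m C(m,k) Ω k ∧ Ω (m-k+1)` for all `m ≥ 0`. -/
def IsGodbillonVey {n : ℕ} (ω : Fin n → HolGerm n) (Ω : ℕ → Fin n → MerGerm n) : Prop :=
  Ω 0 = toMer ω ∧
  ∀ m : ℕ, dForm merPartial (Ω m) = wedge (toMer ω) (Ω (m + 1)) +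
    ∑ k ∈ Finset.Icc 1 m, (m.choose k) • wedge (Ω k) (Ω (m - k + 1))

/-- `ω` has a Godbillon–Vey sequence of length `ℓ` (for `ℓ ≥ 2`): all forms of index at least `ℓ`
vanish. -/
def HasGodbillonVeyOfLength {n : ℕ} (ω : Fin n → HolGerm n) (ℓ : ℕ) : Prop :=
  ∃ Ω : ℕ → Fin n → MerGerm n, IsGodbillonVey ω Ω ∧ ∀ i, ℓ ≤ i → Ω i = 0

/-! ### Differential extensions of the field of germs of meromorphic functions -/

section Extensions

variable {n : ℕ} {L : Type*} [Field L] [Algebra (MerGerm n) L]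

/-- The derivations `D i` make `L` a differential extension of the field of germs of meromorphic
functions: they commute and extend the partial derivatives. -/
structure IsDifferentialExtension (D : Fin n → Derivation ℤ L L) : Prop where
  comm : ∀ i j x, D i (D j x) = D j (D i x)
  extends_partial : ∀ i (f : MerGerm n),
    D i (algebraMap (MerGerm n) L f) = algebraMap (MerGerm n) L (merPartial i f)

/-- A 1-form with coefficients in `K`. -/
def HasCoeffsIn (K : IntermediateField (MerGerm n) L) (γ : Fin n → L) : Prop := ∀ i, γ i ∈ K

/-- `dG = γ` with `γ` a 1-form with coefficients in `K`. -/
def DarbouxStep (D : Fin n → Derivation ℤ L L) (K : IntermediateField (MerGerm n) L)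
    (G : L) : Prop :=
  ∃ γ : Fin n → L, HasCoeffsIn K γ ∧ dFun D G = γ

/-- `dG = G γ₁ + γ₀` with `γ₁, γ₀` 1-forms with coefficients in `K`. -/
def LiouvilleStep (D : Fin n → Derivation ℤ L L) (K : IntermediateField (MerGerm n) L)
    (G : L) : Prop :=
  ∃ γ₁ γ₀ : Fin n → L, HasCoeffsIn K γ₁ ∧ HasCoeffsIn K γ₀ ∧ dFun D G = G • γ₁ + γ₀

/-- `dG = (G² / 2) γ₂ + G γ₁ + γ₀` with `γ₂, γ₁, γ₀` 1-forms with coefficients in `K`. -/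
def RiccatiStep (D : Fin n → Derivation ℤ L L) (K : IntermediateField (MerGerm n) L)
    (G : L) : Prop :=
  ∃ γ₂ γ₁ γ₀ : Fin n → L, HasCoeffsIn K γ₂ ∧ HasCoeffsIn K γ₁ ∧ HasCoeffsIn K γ₀ ∧
    dFun D G = (G ^ 2 / 2) • γ₂ + G • γ₁ + γ₀

/-- `L` is obtained from the field of germs of meromorphic functions by a finite sequence of
differential extensions `E 0 ⊆ E 1 ⊆ … ⊆ E m = L`, each of which is either algebraic or of the form
`E (i+1) = E i (G)` with `G` satisfying the condition `step` over `E i`. -/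
def IsTower (D : Fin n → Derivation ℤ L L)
    (step : IntermediateField (MerGerm n) L → L → Prop) : Prop :=
  ∃ (m : ℕ) (E : ℕ → IntermediateField (MerGerm n) L),
    E 0 = ⊥ ∧ E m = ⊤ ∧
    (∀ i ≤ m, ∀ j, ∀ x ∈ E i, D j x ∈ E i) ∧
    ∀ i < m, E i ≤ E (i + 1) ∧
      ((∀ x ∈ E (i + 1), IsAlgebraic (E i) x) ∨
        ∃ G : L, step (E i) G ∧
          E (i + 1) = (IntermediateField.adjoin (E i) {G}).restrictScalars (MerGerm n))

/-- The 1-form over `L` given by a holomorphic one. -/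
def toExt (L : Type*) [Field L] [Algebra (MerGerm n) L] (ω : Fin n → HolGerm n) : Fin n → L :=
  fun i => algebraMap (MerGerm n) L (toMer ω i)

/-- `H` is a first integral of the foliation `ω = 0`: it is not constant, and `dH ∧ ω = 0`. -/
def IsFirstIntegral (D : Fin n → Derivation ℤ L L) (ω : Fin n → HolGerm n) (H : L) : Prop :=
  dFun D H ≠ 0 ∧ wedge (dFun D H) (toExt L ω) = 0

end Extensions

/-- The foliation `ω = 0` has a first integral of Darboux type. -/
def HasDarbouxFirstIntegral {n : ℕ} (ω : Fin n → HolGerm n) : Prop :=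
  ∃ (L : Type) (_ : Field L) (_ : Algebra (MerGerm n) L) (D : Fin n → Derivation ℤ L L),
    IsDifferentialExtension D ∧ IsTower D (DarbouxStep D) ∧ ∃ H : L, IsFirstIntegral D ω H

/-- The foliation `ω = 0` has a first integral of Liouville type. -/
def HasLiouvilleFirstIntegral {n : ℕ} (ω : Fin n → HolGerm n) : Prop :=
  ∃ (L : Type) (_ : Field L) (_ : Algebra (MerGerm n) L) (D : Fin n → Derivation ℤ L L),
    IsDifferentialExtension D ∧ IsTower D (LiouvilleStep D) ∧ ∃ H : L, IsFirstIntegral D ω H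

/-- The foliation `ω = 0` has a first integral of Riccati type. -/
def HasRiccatiFirstIntegral {n : ℕ} (ω : Fin n → HolGerm n) : Prop :=
  ∃ (L : Type) (_ : Field L) (_ : Algebra (MerGerm n) L) (D : Fin n → Derivation ℤ L L),
    IsDifferentialExtension D ∧ IsTower D (RiccatiStep D) ∧ ∃ H : L, IsFirstIntegral D ω H

/-- `ω` has a Godbillon–Vey sequence of length one: there are a nonzero germ of meromorphic
function `F` and an integer `k ≥ 1` with `d(F^(1/k) ω) = 0`. The multivalued function `F^(1/k)` is a
`k`-th root `Φ` of `F` in a differential extension of the field of germs of meromorphic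
functions. -/
def HasGodbillonVeyOfLengthOne {n : ℕ} (ω : Fin n → HolGerm n) : Prop :=
  ∃ (F : MerGerm n) (k : ℕ), F ≠ 0 ∧ 1 ≤ k ∧
    ∃ (L : Type) (_ : Field L) (_ : Algebra (MerGerm n) L) (D : Fin n → Derivation ℤ L L),
      IsDifferentialExtension D ∧
      ∃ Φ : L, Φ ^ k = algebraMap (MerGerm n) L F ∧ dForm D (Φ • toExt L ω) = 0

end GVFoliation

end

/-!
The three equivalences come from one linear equation. Since `ω ∧ dω = 0`, there are meromorphic forms
`w₁`, `w₂` with `dω = ω ∧ w₁` and `dw₁ = ω ∧ w₂` (`exists_godbillonVey_start`); they stay fixed. Over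
every differential extension the data on both sides are governed by equations
`df ∧ ω + k f dω = θ` (`Solves`), which are linear in the unknown `f` and involve only the
derivations tangent to the foliation:

* `Φ` is an integrating factor, that is `d(Φ ω) = 0`, if and only if it solves the equation with
  `k = 1`, `θ = 0`, and if and only if `Φ ^ k` solves the one of weight `k` with `θ = 0`
  (`solves_pow_iff`);
* `w₁ + g ω` is closed if and only if `g` solves the equation with `k = 1`, `θ = -dw₁`;
* `w₁`, `w₂ + f ω` continue `ω` to a Godbillon–Vey sequence of length three if and only if `f` solves
  the equation with `k = 2`, `θ = w₁ ∧ w₂ - dw₂`. Every Godbillon–Vey sequence of length three is of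
  this form after a change of gauge (`exists_solves_of_isProjectivePair`).

From a first integral `H` one gets the integrating factor `dH / ω` over the top field `L` of the
tower, hence a solution over `L` of each of these equations. Solutions descend from `E'` to `E` along
one step of the tower. If the step is algebraic, the minimal polynomial of a solution has as second
coefficient, up to a factor, a solution of the same equation, and as constant coefficient a solution
of the homogeneous equation with another weight (`coeff_minpoly_relation`). If `E' = E(G)` with `G`
transcendental, a solution is a quotient `P(G) / Q(G)`, and one compares leading coefficients at
`G = ∞` (`top_coeff_relation`). When `dG` is affine in `G` and the solution has no pole at `∞`, its
value there is a solution; when it has a pole, the leading coefficient `h` gives the closed form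
`(dh / h + N γ₁) / k`, a multiplier for `ω`. In the Riccati case one moves a pole to `∞` by
`u = 1 / (G - α)` with `α` algebraic over `E`; a pole at `∞` forces `γ₂ ∧ ω = 0`, and then either
`γ₂ = 0` and the previous argument applies, or `γ₂` is a nonzero multiple of `ω` and the integrability
conditions of the Riccati equation say that `γ₂`, `γ₁`, `γ₀` start a Godbillon–Vey sequence
(`exists_isProjectivePair_of_pole`). A solution without any pole is constant in `G`.

Conversely, a solution `g` of `dg = g² / 2 ω + g ω₁ + ω₂` makes `η = ω₁ + g ω` closed, a solution of
`dF = F η` is an integrating factor, and a primitive of `F ω` is a first integral. These integrable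
equations are solved by a new variable in a field of rational functions
(`exists_rational_derivations`). A `k`-th root is found in the algebraic closure, to which the
derivations extend (`exists_derivation_extension`).
-/

noncomputable section

namespace GVFoliation

open Polynomial

/-! ### Extension of derivations -/

/-- A derivation extends along a formally étale extension, because such an extension does not
change the module of Kähler differentials except for the base change. -/
theorem exists_derivation_extension {A B : Type*} [CommRing A] [CommRing B] [Algebra A B]
    [Algebra.FormallyEtale A B] (d : Derivation ℤ A A) :
    ∃ D : Derivation ℤ B B, ∀ a, D (algebraMap A B a) = algebraMap A B (d a) := by
  let φ : Ω[A⁄ℤ] →ₗ[A] B := (Algebra.linearMap A B).comp d.liftKaehlerDifferential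
  let ψ : Ω[B⁄ℤ] →ₗ[B] B := (φ.liftBaseChange B).comp
    (KaehlerDifferential.tensorKaehlerEquivOfFormallyEtale ℤ A B).symm.toLinearMap
  refine ⟨ψ.compDer (KaehlerDifferential.D ℤ B), fun a => ?_⟩
  change (φ.liftBaseChange B) ((KaehlerDifferential.tensorKaehlerEquivOfFormallyEtale ℤ A B).symm
    (KaehlerDifferential.D ℤ B (algebraMap A B a))) = _
  rw [KaehlerDifferential.tensorKaehlerEquivOfFormallyEtale_symm_D_algebraMap]
  simp [φ]

theorem derivation_eq_zero_of_formallyUnramified {A B N : Type*} [CommRing A] [CommRing B]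
    [Algebra A B] [Algebra.FormallyUnramified A B] [AddCommGroup N] [Module B N]
    (D : Derivation ℤ B N) (h : ∀ a, D (algebraMap A B a) = 0) : D = 0 := by
  let : Module A N := Module.compHom N (algebraMap A B)
  have hs : ∀ (a : A) (x : N), a • x = algebraMap A B a • x := fun _ _ => rfl
  have : IsScalarTower A B N := ⟨fun a b x => by rw [hs, Algebra.smul_def, mul_smul]⟩
  let D' : Derivation A B N := Derivation.mk'
    { toFun := D, map_add' := D.map_add, map_smul' := fun a x => by
        change D (a • x) = a • D x
        rw [Algebra.smul_def, D.leibniz, h, smul_zero, add_zero, hs] } (fun x y => D.leibniz x y)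
  have : D' = 0 := by
    rw [← D'.liftKaehlerDifferential_comp, Subsingleton.elim D'.liftKaehlerDifferential 0]
    ext; rfl
  ext x
  exact congrArg (fun T : Derivation A B N => T x) this

/-- Derivations extending commuting derivations along a formally unramified extension commute. -/
theorem comm_of_formallyUnramified {A B : Type*} [CommRing A] [CommRing B] [Algebra A B]
    [Algebra.FormallyUnramified A B] {d₁ d₂ : Derivation ℤ A A} {D₁ D₂ : Derivation ℤ B B}
    (h₁ : ∀ a, D₁ (algebraMap A B a) = algebraMap A B (d₁ a))
    (h₂ : ∀ a, D₂ (algebraMap A B a) = algebraMap A B (d₂ a))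
    (h : ∀ a, d₁ (d₂ a) = d₂ (d₁ a)) (x : B) : D₁ (D₂ x) = D₂ (D₁ x) := by
  have := derivation_eq_zero_of_formallyUnramified (A := A) ⁅D₁, D₂⁆
    (fun a => by simp [Derivation.commutator_apply, h₁, h₂, h])
  rw [← sub_eq_zero, ← Derivation.commutator_apply, this, Derivation.zero_apply]

/-! ### The derivation of a polynomial ring with a prescribed derivative of the variable -/

section PolyDer

variable {E M : Type*} [Field E] [Field M] [Algebra E M]

/-- The derivation of `E[X]` that extends `δ` and takes the value `v` at `X`. -/
def polyDer (δ : Derivation ℤ E E) (v : E[X]) : Derivation ℤ E[X] E[X] :=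
  letI : Differential E := ⟨δ⟩
  Differential.implicitDeriv v

theorem coeff_polyDer (δ : Derivation ℤ E E) (v p : E[X]) (i : ℕ) :
    (polyDer δ v p).coeff i = δ (p.coeff i) + (v * derivative p).coeff i := by
  let : Differential E := ⟨δ⟩
  change (Differential.implicitDeriv v p).coeff i = _
  simp only [Differential.implicitDeriv, Derivation.add_apply, coeff_add,
    Differential.coeff_mapCoeffs]
  rfl

@[simp]
theorem polyDer_C (δ : Derivation ℤ E E) (v : E[X]) (a : E) : polyDer δ v (C a) = C (δ a) :=
  let : Differential E := ⟨δ⟩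
  Differential.implicitDeriv_C v a

@[simp]
theorem polyDer_X (δ : Derivation ℤ E E) (v : E[X]) : polyDer δ v X = v :=
  let : Differential E := ⟨δ⟩
  Differential.implicitDeriv_X v

theorem derivation_aeval {δ : Derivation ℤ E E} {D : Derivation ℤ M M}
    (hD : ∀ a, D (algebraMap E M a) = algebraMap E M (δ a)) {x : M} {v : E[X]}
    (hx : D x = aeval x v) (p : E[X]) : D (aeval x p) = aeval x (polyDer δ v p) := by
  let : Differential E := ⟨δ⟩
  let : Differential M := ⟨D⟩
  have : DifferentialAlgebra E M := ⟨hD⟩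
  exact Differential.deriv_aeval_eq_implicitDeriv x v hx p

end PolyDer

/-! ### First order linear equations over algebraic and rational extensions -/

section Descent

variable {E M : Type*} [Field E] [Field M] [Algebra E M]

theorem coeff_X_mul_derivative (p : E[X]) (i : ℕ) :
    (X * derivative p).coeff i = i * p.coeff i := by
  cases i with
  | zero => simp
  | succ i => rw [coeff_X_mul, coeff_derivative]; push_cast; ring

/-- An algebraic solution of `x' + c x = θ` makes the coefficients of its minimal polynomial satisfy
linear equations: differentiating the minimal polynomial at the solution gives a polynomial of the
same degree that vanishes there, hence a multiple of the minimal polynomial by a scalar. -/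
theorem coeff_minpoly_relation {δ : Derivation ℤ E E} {D : Derivation ℤ M M}
    (hD : ∀ a, D (algebraMap E M a) = algebraMap E M (δ a)) {f : M} (hf : IsAlgebraic E f)
    {c θ : E} (h : D f + algebraMap E M c * f = algebraMap E M θ) (i : ℕ) :
    δ ((minpoly E f).coeff i) + (i + 1) * θ * (minpoly E f).coeff (i + 1) +
      ((minpoly E f).natDegree - i) * c * (minpoly E f).coeff i = 0 := by
  set p := minpoly E f with hp
  have hmon : p.Monic := minpoly.monic hf.isIntegral
  have hv : D f = aeval f (C θ - C c * X : E[X]) := by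
    rw [eq_sub_of_add_eq h]; simp
  have h0 := derivation_aeval hD hv p
  rw [hp, minpoly.aeval, map_zero, ← hp] at h0
  have hco : ∀ j, (polyDer δ (C θ - C c * X) p + C (p.natDegree * c) * p).coeff j =
      δ (p.coeff j) + (j + 1) * θ * p.coeff (j + 1) + (p.natDegree - j) * c * p.coeff j := by
    intro j
    rw [coeff_add, coeff_polyDer, sub_mul, coeff_sub, coeff_C_mul, coeff_C_mul, mul_assoc (C c),
      coeff_C_mul, coeff_X_mul_derivative, coeff_derivative]
    ring
  have hr : polyDer δ (C θ - C c * X) p + C (p.natDegree * c) * p = 0 := by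
    by_contra hne
    have hdvd : p ∣ polyDer δ (C θ - C c * X) p + C (p.natDegree * c) * p := by
      rw [hp]
      refine minpoly.dvd E f ?_
      rw [map_add, ← hp, ← h0, map_mul, hp, minpoly.aeval, mul_zero, add_zero]
    have hle := natDegree_le_of_dvd hdvd hne
    have hlead := hne ∘ leadingCoeff_eq_zero.1
    refine hlead ?_
    rw [leadingCoeff, hco]
    rcases hle.eq_or_lt with he | hlt
    · rw [← he, hmon.coeff_natDegree, coeff_eq_zero_of_natDegree_lt (Nat.lt_succ_self _)]
      simp
    · rw [coeff_eq_zero_of_natDegree_lt hlt,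
        coeff_eq_zero_of_natDegree_lt (hlt.trans (Nat.lt_succ_self _))]
      simp
  rw [← hco, hr, coeff_zero]

theorem algebraic_solution_descends [CharZero E] {δ : Derivation ℤ E E} {D : Derivation ℤ M M}
    (hD : ∀ a, D (algebraMap E M a) = algebraMap E M (δ a)) {f : M} (hf : IsAlgebraic E f)
    {c θ : E} (h : D f + algebraMap E M c * f = algebraMap E M θ) :
    δ (-(minpoly E f).nextCoeff / (minpoly E f).natDegree) +
      c * (-(minpoly E f).nextCoeff / (minpoly E f).natDegree) = θ := by
  have hmon : (minpoly E f).Monic := minpoly.monic hf.isIntegral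
  have hpos : 0 < (minpoly E f).natDegree := minpoly.natDegree_pos hf.isIntegral
  have hr := coeff_minpoly_relation hD hf h ((minpoly E f).natDegree - 1)
  rw [Nat.sub_add_cancel hpos, hmon.coeff_natDegree, Nat.cast_sub hpos,
    ← nextCoeff_of_natDegree_pos hpos] at hr
  have hd : ((minpoly E f).natDegree : E) ≠ 0 := Nat.cast_ne_zero.2 hpos.ne'
  have hδ : δ ((minpoly E f).natDegree : E) = 0 := δ.map_natCast _
  rw [Derivation.leibniz_div, hδ, map_neg]
  simp only [smul_eq_mul, mul_zero, sub_zero]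
  field_simp
  push_cast at hr
  linear_combination -hr

theorem algebraic_homogeneous_solution_descends {δ : Derivation ℤ E E} {D : Derivation ℤ M M}
    (hD : ∀ a, D (algebraMap E M a) = algebraMap E M (δ a)) {f : M} (hf : IsAlgebraic E f)
    {c : E} (h : D f + algebraMap E M c * f = 0) :
    δ ((minpoly E f).coeff 0) + (minpoly E f).natDegree * c * (minpoly E f).coeff 0 = 0 := by
  have hr := coeff_minpoly_relation hD hf (h.trans (map_zero (algebraMap E M)).symm) 0
  simpa using hr

/-- A rational expression `P(G) / Q(G)` in a transcendental element solves a linear equation only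
if the corresponding identity holds between polynomials. -/
theorem rational_solution_identity {δ : Derivation ℤ E E} {D : Derivation ℤ M M}
    (hD : ∀ a, D (algebraMap E M a) = algebraMap E M (δ a)) {G : M} (hG : Transcendental E G)
    {v : E[X]} (hv : D G = aeval G v) {P Q : E[X]} (hQ : Q ≠ 0) {c θ : E}
    (h : D (aeval G P / aeval G Q) + algebraMap E M c * (aeval G P / aeval G Q) =
      algebraMap E M θ) :
    Q * polyDer δ v P - P * polyDer δ v Q + C c * (P * Q) = C θ * (Q * Q) := by
  have hQG : aeval G Q ≠ 0 := fun h0 => hQ ((transcendental_iff.1 hG) Q h0)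
  refine sub_eq_zero.1 ((transcendental_iff.1 hG) _ ?_)
  simp only [map_sub, map_add, map_mul, aeval_C, ← derivation_aeval hD hv]
  rw [Derivation.leibniz_div] at h
  simp only [smul_eq_mul] at h
  field_simp at h
  linear_combination h

theorem coeff_polyDer_quadratic (δ : Derivation ℤ E E) (a b e : E) (P : E[X]) (i : ℕ) :
    (polyDer δ (C a * X ^ 2 + C b * X + C e) P).coeff (i + 1) =
      δ (P.coeff (i + 1)) + a * (i * P.coeff i) + b * ((i + 1) * P.coeff (i + 1)) +
        e * ((i + 2) * P.coeff (i + 2)) := by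
  have : (C a * X ^ 2 + C b * X + C e) * derivative P =
      C a * (X * (X * derivative P)) + C b * (X * derivative P) + C e * derivative P := by ring
  rw [coeff_polyDer, this, coeff_add, coeff_add, coeff_C_mul, coeff_C_mul, coeff_C_mul, coeff_X_mul,
    coeff_X_mul_derivative, coeff_X_mul_derivative, coeff_derivative]
  push_cast
  ring

theorem natDegree_polyDer_quadratic_le (δ : Derivation ℤ E E) (a b e : E) {P : E[X]} {m : ℕ}
    (hP : P.natDegree ≤ m) :
    (polyDer δ (C a * X ^ 2 + C b * X + C e) P).natDegree ≤ m + 1 := by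
  refine natDegree_le_iff_coeff_eq_zero.2 fun N hN => ?_
  obtain ⟨N, rfl⟩ : ∃ k, N = k + 1 := ⟨N - 1, by omega⟩
  rw [coeff_polyDer_quadratic, coeff_eq_zero_of_natDegree_lt (by omega),
    coeff_eq_zero_of_natDegree_lt (by omega), coeff_eq_zero_of_natDegree_lt (by omega)]
  simp

theorem coeff_polyDer_linear (δ : Derivation ℤ E E) (b e : E) (P : E[X]) (i : ℕ) :
    (polyDer δ (C b * X + C e) P).coeff i =
      δ (P.coeff i) + b * (i * P.coeff i) + e * ((i + 1) * P.coeff (i + 1)) := by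
  rw [coeff_polyDer, add_mul, mul_assoc, coeff_add, coeff_C_mul, coeff_C_mul,
    coeff_X_mul_derivative, coeff_derivative]
  ring

theorem natDegree_polyDer_linear_le (δ : Derivation ℤ E E) (b e : E) {P : E[X]} {m : ℕ}
    (hP : P.natDegree ≤ m) : (polyDer δ (C b * X + C e) P).natDegree ≤ m := by
  refine natDegree_le_iff_coeff_eq_zero.2 fun N hN => ?_
  rw [coeff_polyDer_linear, coeff_eq_zero_of_natDegree_lt (by omega),
    coeff_eq_zero_of_natDegree_lt (by omega)]
  simp

/-- If a rational expression with a pole at infinity solves a linear equation, then the place at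
infinity is invariant: the derivative of the generator has no quadratic term. -/
theorem quadratic_term_eq_zero [CharZero E] {δ : Derivation ℤ E E} {D : Derivation ℤ M M}
    (hD : ∀ a, D (algebraMap E M a) = algebraMap E M (δ a)) {G : M} (hG : Transcendental E G)
    {a b e : E} (hv : D G = algebraMap E M a * G ^ 2 + algebraMap E M b * G + algebraMap E M e)
    {P Q : E[X]} (hQ : Q ≠ 0) (hPQ : Q.natDegree < P.natDegree) {c θ : E}
    (h : D (aeval G P / aeval G Q) + algebraMap E M c * (aeval G P / aeval G Q) =
      algebraMap E M θ) : a = 0 := by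
  have hv' : D G = aeval G (C a * X ^ 2 + C b * X + C e : E[X]) := by rw [hv]; simp
  have hid := congrArg (fun R => R.coeff (Q.natDegree + (P.natDegree + 1)))
    (rational_solution_identity hD hG hv' hQ h)
  simp only [coeff_add, coeff_sub, coeff_C_mul] at hid
  rw [coeff_mul_add_eq_of_natDegree_le le_rfl (natDegree_polyDer_quadratic_le δ a b e le_rfl),
    show Q.natDegree + (P.natDegree + 1) = P.natDegree + (Q.natDegree + 1) by ring,
    coeff_mul_add_eq_of_natDegree_le le_rfl (natDegree_polyDer_quadratic_le δ a b e le_rfl),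
    coeff_polyDer_quadratic, coeff_polyDer_quadratic,
    coeff_eq_zero_of_natDegree_lt (p := P * Q) (by have := natDegree_mul_le (p := P) (q := Q); omega),
    coeff_eq_zero_of_natDegree_lt (p := Q * Q) (by have := natDegree_mul_le (p := Q) (q := Q); omega),
    coeff_eq_zero_of_natDegree_lt (p := P) (n := P.natDegree + 1) (by omega),
    coeff_eq_zero_of_natDegree_lt (p := P) (n := P.natDegree + 2) (by omega),
    coeff_eq_zero_of_natDegree_lt (p := Q) (n := Q.natDegree + 1) (by omega),
    coeff_eq_zero_of_natDegree_lt (p := Q) (n := Q.natDegree + 2) (by omega)] at hid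
  have hP : P.coeff P.natDegree ≠ 0 := by
    rw [coeff_natDegree, leadingCoeff_ne_zero]; rintro rfl; simp at hPQ
  have hQ' : Q.coeff Q.natDegree ≠ 0 := by rwa [coeff_natDegree, leadingCoeff_ne_zero]
  have hN : (P.natDegree : E) - Q.natDegree ≠ 0 :=
    sub_ne_zero.2 (Nat.cast_injective.ne hPQ.ne')
  simp only [map_zero, mul_zero, add_zero, zero_add] at hid
  have : a * (((P.natDegree : E) - Q.natDegree) * (P.coeff P.natDegree * Q.coeff Q.natDegree)) = 0 := by
    linear_combination hid
  exact (mul_eq_zero.1 this).resolve_right (mul_ne_zero hN (mul_ne_zero hP hQ'))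

/-- Comparison of the top coefficients, when the derivative of the generator is affine. -/
theorem top_coeff_relation {δ : Derivation ℤ E E} {D : Derivation ℤ M M}
    (hD : ∀ a, D (algebraMap E M a) = algebraMap E M (δ a)) {G : M} (hG : Transcendental E G)
    {b e : E} (hv : D G = algebraMap E M b * G + algebraMap E M e)
    {P Q : E[X]} (hQ : Q ≠ 0) {m : ℕ} (hm : P.natDegree ≤ m) {c θ : E}
    (h : D (aeval G P / aeval G Q) + algebraMap E M c * (aeval G P / aeval G Q) =
      algebraMap E M θ) :
    δ (P.coeff m / Q.leadingCoeff) +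
      (((m : E) - Q.natDegree) * b + c) * (P.coeff m / Q.leadingCoeff) =
      θ * (Q * Q).coeff (m + Q.natDegree) / (Q.leadingCoeff * Q.leadingCoeff) := by
  have hv' : D G = aeval G (C b * X + C e : E[X]) := by rw [hv]; simp
  have hid := congrArg (fun R => R.coeff (m + Q.natDegree))
    (rational_solution_identity hD hG hv' hQ h)
  simp only [coeff_add, coeff_sub, coeff_C_mul] at hid
  rw [mul_comm Q (polyDer _ _ P),
    coeff_mul_add_eq_of_natDegree_le (natDegree_polyDer_linear_le δ b e hm) le_rfl,
    coeff_mul_add_eq_of_natDegree_le hm (natDegree_polyDer_linear_le δ b e le_rfl),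
    coeff_mul_add_eq_of_natDegree_le hm le_rfl, coeff_polyDer_linear, coeff_polyDer_linear,
    coeff_eq_zero_of_natDegree_lt (p := P) (n := m + 1) (by omega),
    coeff_eq_zero_of_natDegree_lt (p := Q) (n := Q.natDegree + 1) (by omega)] at hid
  have hq : Q.leadingCoeff ≠ 0 := leadingCoeff_ne_zero.2 hQ
  rw [coeff_natDegree] at hid
  rw [Derivation.leibniz_div]
  simp only [smul_eq_mul]
  field_simp
  linear_combination hid

/-- A solution without pole at infinity takes there a value that is again a solution. -/
theorem value_at_infinity_relation {δ : Derivation ℤ E E} {D : Derivation ℤ M M}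
    (hD : ∀ a, D (algebraMap E M a) = algebraMap E M (δ a)) {G : M} (hG : Transcendental E G)
    {b e : E} (hv : D G = algebraMap E M b * G + algebraMap E M e)
    {P Q : E[X]} (hQ : Q ≠ 0) (hPQ : P.natDegree ≤ Q.natDegree) {c θ : E}
    (h : D (aeval G P / aeval G Q) + algebraMap E M c * (aeval G P / aeval G Q) =
      algebraMap E M θ) :
    δ (P.coeff Q.natDegree / Q.leadingCoeff) + c * (P.coeff Q.natDegree / Q.leadingCoeff) = θ := by
  have hr := top_coeff_relation hD hG hv hQ hPQ h
  have hq : Q.leadingCoeff ≠ 0 := leadingCoeff_ne_zero.2 hQ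
  rwa [sub_self, zero_mul, zero_add, coeff_mul_add_eq_of_natDegree_le le_rfl le_rfl, coeff_natDegree,
    mul_div_assoc, div_self (mul_ne_zero hq hq), mul_one] at hr

/-- The leading coefficient at infinity of a solution solves a homogeneous equation, if either the
solution has a pole at infinity or the given equation is homogeneous. -/
theorem leadingCoeff_relation {δ : Derivation ℤ E E} {D : Derivation ℤ M M}
    (hD : ∀ a, D (algebraMap E M a) = algebraMap E M (δ a)) {G : M} (hG : Transcendental E G)
    {b e : E} (hv : D G = algebraMap E M b * G + algebraMap E M e)
    {P Q : E[X]} (hQ : Q ≠ 0) {c θ : E} (hθ : Q.natDegree < P.natDegree ∨ θ = 0)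
    (h : D (aeval G P / aeval G Q) + algebraMap E M c * (aeval G P / aeval G Q) =
      algebraMap E M θ) :
    δ (P.leadingCoeff / Q.leadingCoeff) +
      (((P.natDegree : E) - Q.natDegree) * b + c) * (P.leadingCoeff / Q.leadingCoeff) = 0 := by
  have hr := top_coeff_relation hD hG hv hQ le_rfl h
  rw [coeff_natDegree] at hr
  rw [hr]
  rcases hθ with hlt | rfl
  · rw [coeff_eq_zero_of_natDegree_lt (p := Q * Q)
      (by have := natDegree_mul_le (p := Q) (q := Q); omega)]
    simp
  · simp

end Descent

/-! ### Godbillon–Vey data over a differential field -/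

section Forms

variable {n : ℕ} {E : Type*} [Field E]

theorem wedge_apply (α β : Fin n → E) (i j : Fin n) : wedge α β i j = α i * β j - α j * β i := rfl

theorem dForm_apply (δ : Fin n → Derivation ℤ E E) (α : Fin n → E) (i j : Fin n) :
    dForm δ α i j = δ i (α j) - δ j (α i) := rfl

theorem exists_smul_of_wedge_eq_zero {ω α : Fin n → E} (hω : ω ≠ 0) (h : wedge ω α = 0) :
    ∃ g : E, α = g • ω := by
  obtain ⟨p, hp⟩ := Function.ne_iff.1 hω
  have hp : ω p ≠ 0 := hp
  refine ⟨α p / ω p, funext fun i => ?_⟩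
  have := congrFun (congrFun h p) i
  simp only [wedge_apply, Pi.zero_apply] at this
  simp only [Pi.smul_apply, smul_eq_mul]
  field_simp
  linear_combination this

/-- A 2-form whose exterior product with `ω ≠ 0` vanishes is divisible by `ω`. -/
theorem exists_wedge_of_wedge₂_eq_zero {ω : Fin n → E} (hω : ω ≠ 0) {θ : Fin n → Fin n → E}
    (h : wedge₂ ω θ = 0) : ∃ η, θ = wedge ω η := by
  obtain ⟨p, hp⟩ := Function.ne_iff.1 hω
  have hp : ω p ≠ 0 := hp
  refine ⟨fun i => θ p i / ω p, funext fun i => funext fun j => ?_⟩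
  have := congrFun (congrFun (congrFun h p) i) j
  simp only [wedge₂, Pi.zero_apply] at this
  rw [wedge_apply]
  field_simp
  linear_combination this

/-- The derivation `ω_j ∂_i - ω_i ∂_j`, which is tangent to the foliation `ω = 0`. -/
def tangentDer (δ : Fin n → Derivation ℤ E E) (ω : Fin n → E) (i j : Fin n) : Derivation ℤ E E :=
  ω j • δ i - ω i • δ j

theorem tangentDer_apply (δ : Fin n → Derivation ℤ E E) (ω : Fin n → E) (i j : Fin n) (f : E) :
    tangentDer δ ω i j f = ω j * δ i f - ω i * δ j f := rfl

/-- `f` solves the equation `df ∧ ω + k f dω = θ`. -/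
def Solves (δ : Fin n → Derivation ℤ E E) (ω : Fin n → E) (k : ℕ) (θ : Fin n → Fin n → E)
    (f : E) : Prop :=
  ∀ i j, tangentDer δ ω i j f + k * dForm δ ω i j * f = θ i j

/-- Forms `ω₁`, `ω₂` that continue `ω` to a Godbillon–Vey sequence of length three. -/
structure IsProjectivePair (δ : Fin n → Derivation ℤ E E) (ω ω₁ ω₂ : Fin n → E) : Prop where
  d_zero : dForm δ ω = wedge ω ω₁
  d_one : dForm δ ω₁ = wedge ω ω₂
  d_two : dForm δ ω₂ = wedge ω₁ ω₂

/-- A closed form `η` with `dω = ω ∧ η`, which continues `ω` to a Godbillon–Vey sequence of length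
two. -/
structure IsClosedMultiplier (δ : Fin n → Derivation ℤ E E) (ω η : Fin n → E) : Prop where
  d_zero : dForm δ ω = wedge ω η
  closed : dForm δ η = 0

variable {δ : Fin n → Derivation ℤ E E} {ω : Fin n → E}

theorem IsClosedMultiplier.isProjectivePair {η : Fin n → E} (h : IsClosedMultiplier δ ω η) :
    IsProjectivePair δ ω η 0 where
  d_zero := h.d_zero
  d_one := by rw [h.closed]; ext; simp [wedge]
  d_two := by ext; simp [wedge, dForm]

/-- The exterior derivative of `dω = ω ∧ w` gives `ω ∧ dw = 0`. -/
theorem wedge₂_dForm_eq_zero (hcomm : ∀ i j x, δ i (δ j x) = δ j (δ i x)) {w : Fin n → E}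
    (h : dForm δ ω = wedge ω w) : wedge₂ ω (dForm δ w) = 0 := by
  ext i j k
  have h' : ∀ i j, δ i (ω j) - δ j (ω i) = ω i * w j - ω j * w i := fun i j =>
    congrFun (congrFun h i) j
  have e1 := congrArg (δ i) (h' j k)
  have e2 := congrArg (δ j) (h' i k)
  have e3 := congrArg (δ k) (h' i j)
  simp only [map_sub, Derivation.leibniz, smul_eq_mul] at e1 e2 e3
  simp only [wedge₂, dForm_apply, Pi.zero_apply]
  rw [hcomm j i] at e2
  rw [hcomm k i, hcomm k j] at e3
  linear_combination e1 - e2 + e3 + w i * h' j k - w j * h' i k + w k * h' i j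

theorem exists_godbillonVey_start (hcomm : ∀ i j x, δ i (δ j x) = δ j (δ i x)) (hω : ω ≠ 0)
    (hint : wedge₂ ω (dForm δ ω) = 0) :
    ∃ w₁ w₂, dForm δ ω = wedge ω w₁ ∧ dForm δ w₁ = wedge ω w₂ := by
  obtain ⟨w₁, h₁⟩ := exists_wedge_of_wedge₂_eq_zero hω hint
  obtain ⟨w₂, h₂⟩ := exists_wedge_of_wedge₂_eq_zero hω (wedge₂_dForm_eq_zero hcomm h₁)
  exact ⟨w₁, w₂, h₁, h₂⟩

theorem exists_solves_of_isClosedMultiplier (hω : ω ≠ 0) {w₁ η : Fin n → E}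
    (hw : dForm δ ω = wedge ω w₁) (hη : IsClosedMultiplier δ ω η) :
    ∃ g, Solves δ ω 1 (-dForm δ w₁) g := by
  obtain ⟨g, hg⟩ := exists_smul_of_wedge_eq_zero (α := η - w₁) hω (by
    have := hη.d_zero.symm.trans hw
    ext i j
    have := congrFun (congrFun this i) j
    simp only [wedge_apply, Pi.sub_apply, Pi.zero_apply] at this ⊢
    linear_combination this)
  obtain rfl : η = w₁ + g • ω := by rw [← hg]; abel
  refine ⟨g, fun i j => ?_⟩
  have := congrFun (congrFun hη.closed i) j
  simp only [dForm_apply, Pi.add_apply, Pi.smul_apply, map_add, smul_eq_mul, Derivation.leibniz,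
    Pi.zero_apply] at this
  simp only [tangentDer_apply, dForm_apply, Pi.neg_apply, Nat.cast_one]
  linear_combination this

theorem Solves.isClosedMultiplier {w₁ : Fin n → E} (hw : dForm δ ω = wedge ω w₁) {g : E}
    (hg : Solves δ ω 1 (-dForm δ w₁) g) : IsClosedMultiplier δ ω (w₁ + g • ω) where
  d_zero := by
    rw [hw]
    ext i j
    simp only [wedge_apply, Pi.add_apply, Pi.smul_apply, smul_eq_mul]
    ring
  closed := by
    ext i j
    have := hg i j
    simp only [dForm_apply, Pi.add_apply, Pi.smul_apply, map_add, smul_eq_mul, Derivation.leibniz,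
      Pi.zero_apply]
    simp only [tangentDer_apply, dForm_apply, Pi.neg_apply, Nat.cast_one] at this
    linear_combination this

/-- The change of gauge `ω₁ ↦ ω₁ + g ω` in a Godbillon–Vey sequence of length three. -/
theorem IsProjectivePair.gauge [CharZero E] (hcomm : ∀ i j x, δ i (δ j x) = δ j (δ i x))
    {ω₁ ω₂ : Fin n → E} (h : IsProjectivePair δ ω ω₁ ω₂) (g : E) :
    IsProjectivePair δ ω (ω₁ + g • ω) (ω₂ + g • ω₁ - dFun δ g + (g ^ 2 / 2) • ω) := by
  have h0 : ∀ i j, δ i (ω j) - δ j (ω i) = ω i * ω₁ j - ω j * ω₁ i := fun i j =>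
    congrFun (congrFun h.d_zero i) j
  have h1 : ∀ i j, δ i (ω₁ j) - δ j (ω₁ i) = ω i * ω₂ j - ω j * ω₂ i := fun i j =>
    congrFun (congrFun h.d_one i) j
  have h2 : ∀ i j, δ i (ω₂ j) - δ j (ω₂ i) = ω₁ i * ω₂ j - ω₁ j * ω₂ i := fun i j =>
    congrFun (congrFun h.d_two i) j
  have hdiv : ∀ i, δ i (g ^ 2 / 2) = g * δ i g := fun i => by
    have : δ i (2 : E) = 0 := (δ i).map_natCast 2
    rw [Derivation.leibniz_div, this, pow_two g, Derivation.leibniz]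
    simp only [smul_eq_mul]
    field_simp
    ring
  refine ⟨?_, ?_, ?_⟩ <;> ext i j <;>
    simp only [dForm_apply, wedge_apply, Pi.add_apply, Pi.sub_apply, Pi.smul_apply, smul_eq_mul,
      map_add, map_sub, Derivation.leibniz, dFun, hdiv]
  · linear_combination h0 i j
  · linear_combination h1 i j + g * h0 i j
  · rw [hcomm j i]
    linear_combination h2 i j + g * h1 i j + g ^ 2 / 2 * h0 i j

theorem exists_solves_of_isProjectivePair [CharZero E]
    (hcomm : ∀ i j x, δ i (δ j x) = δ j (δ i x)) (hω : ω ≠ 0) {w₁ w₂ ω₁ ω₂ : Fin n → E}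
    (hw₁ : dForm δ ω = wedge ω w₁) (hw₂ : dForm δ w₁ = wedge ω w₂)
    (h : IsProjectivePair δ ω ω₁ ω₂) : ∃ f, Solves δ ω 2 (wedge w₁ w₂ - dForm δ w₂) f := by
  obtain ⟨g, hg⟩ := exists_smul_of_wedge_eq_zero (α := w₁ - ω₁) hω (by
    have := h.d_zero.symm.trans hw₁
    ext i j
    have := congrFun (congrFun this i) j
    simp only [wedge_apply, Pi.sub_apply, Pi.zero_apply] at this ⊢
    linear_combination -this)
  have hp := h.gauge hcomm g
  rw [← hg, add_sub_cancel] at hp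
  set θ₂ := ω₂ + g • ω₁ - dFun δ g + (g ^ 2 / 2) • ω
  obtain ⟨f, hf⟩ := exists_smul_of_wedge_eq_zero (α := θ₂ - w₂) hω (by
    have := hp.d_one.symm.trans hw₂
    ext i j
    have := congrFun (congrFun this i) j
    simp only [wedge_apply, Pi.sub_apply, Pi.zero_apply] at this ⊢
    linear_combination this)
  rw [show θ₂ = w₂ + f • ω by rw [← hf]; abel] at hp
  refine ⟨f, fun i j => ?_⟩
  have h2 := congrFun (congrFun hp.d_two i) j
  have h0 := congrFun (congrFun hw₁ i) j
  simp only [dForm_apply, Pi.add_apply, Pi.smul_apply, map_add, smul_eq_mul, Derivation.leibniz,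
    wedge_apply] at h2 h0
  simp only [tangentDer_apply, dForm_apply, wedge_apply, Pi.sub_apply, Nat.cast_ofNat]
  linear_combination h2 + f * h0

theorem Solves.isProjectivePair {w₁ w₂ : Fin n → E} (hw₁ : dForm δ ω = wedge ω w₁)
    (hw₂ : dForm δ w₁ = wedge ω w₂) {f : E} (hf : Solves δ ω 2 (wedge w₁ w₂ - dForm δ w₂) f) :
    IsProjectivePair δ ω w₁ (w₂ + f • ω) where
  d_zero := hw₁
  d_one := by
    rw [hw₂]
    ext i j
    simp only [wedge_apply, Pi.add_apply, Pi.smul_apply, smul_eq_mul]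
    ring
  d_two := by
    ext i j
    have h2 := hf i j
    have h0 := congrFun (congrFun hw₁ i) j
    simp only [dForm_apply, Pi.add_apply, Pi.smul_apply, map_add, smul_eq_mul, Derivation.leibniz,
      wedge_apply] at h0 ⊢
    simp only [tangentDer_apply, dForm_apply, wedge_apply, Pi.sub_apply, Nat.cast_ofNat] at h2
    linear_combination h2 - f * h0

/-- A nonzero solution of a homogeneous equation twisted by a closed form `β` gives the closed
multiplier `(dh / h + c β) / k`. -/
theorem isClosedMultiplier_of_homogeneous [CharZero E]
    (hcomm : ∀ i j x, δ i (δ j x) = δ j (δ i x)) {β : Fin n → E} (hβ : dForm δ β = 0) {h : E}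
    (hh : h ≠ 0) {c : E} (hc : ∀ i, δ i c = 0) {k : ℕ} (hk : k ≠ 0)
    (heq : ∀ i j, tangentDer δ ω i j h +
      (c * (ω j * β i - ω i * β j) + k * dForm δ ω i j) * h = 0) :
    IsClosedMultiplier δ ω (fun i => (δ i h / h + c * β i) / k) := by
  have hk' : (k : E) ≠ 0 := Nat.cast_ne_zero.2 hk
  have hdk : ∀ i, δ i (k : E) = 0 := fun i => (δ i).map_natCast k
  constructor
  · ext i j
    have := heq i j
    rw [tangentDer_apply] at this
    rw [wedge_apply]
    field_simp
    linear_combination this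
  · ext i j
    have := congrFun (congrFun hβ i) j
    simp only [dForm_apply, Pi.zero_apply, map_add, Derivation.leibniz_div, Derivation.leibniz,
      smul_eq_mul, hdk, hc, mul_zero, sub_zero, add_zero] at this ⊢
    rw [hcomm j i]
    field_simp
    linear_combination c * h ^ 2 * this

/-- Godbillon–Vey data for a multiple of `ω` give Godbillon–Vey data for `ω`. -/
theorem IsProjectivePair.of_smul {μ : E} (hμ : μ ≠ 0)
    (hcomm : ∀ i j x, δ i (δ j x) = δ j (δ i x)) {ω₁ ω₂ : Fin n → E}
    (h : IsProjectivePair δ (μ • ω) ω₁ ω₂) :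
    IsProjectivePair δ ω (fun i => ω₁ i + δ i μ / μ) (μ • ω₂) := by
  have h0 := fun i j => congrFun (congrFun h.d_zero i) j
  have h1 := fun i j => congrFun (congrFun h.d_one i) j
  have h2 := fun i j => congrFun (congrFun h.d_two i) j
  simp only [dForm_apply, wedge_apply, Pi.smul_apply, smul_eq_mul, Derivation.leibniz] at h0 h1 h2
  refine ⟨?_, ?_, ?_⟩ <;> ext i j <;>
    simp only [dForm_apply, wedge_apply, Pi.smul_apply, smul_eq_mul, map_add,
      Derivation.leibniz_div, Derivation.leibniz]
  · field_simp
    linear_combination h0 i j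
  · rw [hcomm j i]
    field_simp
    linear_combination μ ^ 2 * h1 i j
  · field_simp
    linear_combination μ * h2 i j

end Forms

/-! ### Descent along one step -/

section Step

variable {n : ℕ} {E M : Type*} [Field E] [Field M] [Algebra E M]
  {δ : Fin n → Derivation ℤ E E} {D : Fin n → Derivation ℤ M M}

theorem dForm_algebraMap (hD : ∀ i a, D i (algebraMap E M a) = algebraMap E M (δ i a))
    (α : Fin n → E) (i j : Fin n) :
    dForm D (fun i => algebraMap E M (α i)) i j = algebraMap E M (dForm δ α i j) := by
  simp [dForm_apply, hD]

theorem tangentDer_algebraMap (hD : ∀ i a, D i (algebraMap E M a) = algebraMap E M (δ i a))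
    (ω : Fin n → E) (i j : Fin n) (a : E) :
    tangentDer D (fun i => algebraMap E M (ω i)) i j (algebraMap E M a) =
      algebraMap E M (tangentDer δ ω i j a) := by
  simp [tangentDer_apply, hD]

theorem solves_algebraMap_iff (hD : ∀ i a, D i (algebraMap E M a) = algebraMap E M (δ i a))
    {ω : Fin n → E} {k : ℕ} {θ : Fin n → Fin n → E} {a : E} :
    Solves D (fun i => algebraMap E M (ω i)) k (fun i j => algebraMap E M (θ i j))
      (algebraMap E M a) ↔ Solves δ ω k θ a := by
  refine forall_congr' fun i => forall_congr' fun j => ?_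
  rw [tangentDer_algebraMap hD, dForm_algebraMap hD, ← map_natCast (algebraMap E M), ← map_mul,
    ← map_mul, ← map_add, (algebraMap E M).injective.eq_iff]

theorem Solves.scalar (hD : ∀ i a, D i (algebraMap E M a) = algebraMap E M (δ i a))
    {ω : Fin n → E} {k : ℕ} {θ : Fin n → Fin n → E} {f : M}
    (hf : Solves D (fun i => algebraMap E M (ω i)) k (fun i j => algebraMap E M (θ i j)) f)
    (i j : Fin n) : tangentDer D (fun i => algebraMap E M (ω i)) i j f +
      algebraMap E M (k * dForm δ ω i j) * f = algebraMap E M (θ i j) := by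
  have h := hf i j
  rw [dForm_algebraMap hD] at h
  rw [map_mul, map_natCast]
  exact h

theorem Solves.descend_of_isAlgebraic [CharZero E]
    (hD : ∀ i a, D i (algebraMap E M a) = algebraMap E M (δ i a))
    {ω : Fin n → E} {k : ℕ} {θ : Fin n → Fin n → E} {f : M} (halg : IsAlgebraic E f)
    (hf : Solves D (fun i => algebraMap E M (ω i)) k (fun i j => algebraMap E M (θ i j)) f) :
    ∃ g, Solves δ ω k θ g :=
  ⟨_, fun i j => algebraic_solution_descends (tangentDer_algebraMap hD ω i j) halg
    (hf.scalar hD i j)⟩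

/-- The constant coefficient of the minimal polynomial, which up to sign is the norm, has weight
multiplied by the degree. -/
theorem Solves.descend_homogeneous_of_isAlgebraic
    (hD : ∀ i a, D i (algebraMap E M a) = algebraMap E M (δ i a))
    {ω : Fin n → E} {k : ℕ} (hk : 1 ≤ k) {f : M} (hne : f ≠ 0) (halg : IsAlgebraic E f)
    (hf : Solves D (fun i => algebraMap E M (ω i)) k 0 f) :
    ∃ (g : E) (l : ℕ), g ≠ 0 ∧ 1 ≤ l ∧ Solves δ ω l 0 g := by
  refine ⟨(minpoly E f).coeff 0, (minpoly E f).natDegree * k,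
    minpoly.coeff_zero_ne_zero halg.isIntegral hne,
    Nat.mul_pos (minpoly.natDegree_pos halg.isIntegral) hk, fun i j => ?_⟩
  have h := Solves.scalar hD (θ := 0) (by simp only [Pi.zero_apply, map_zero]; exact hf) i j
  rw [Pi.zero_apply, Pi.zero_apply, map_zero] at h
  have := algebraic_homogeneous_solution_descends (tangentDer_algebraMap hD ω i j) halg h
  rw [← mul_assoc] at this
  rw [Nat.cast_mul]
  exact this

theorem tangentDer_riccati {γ₂ γ₁ γ₀ : Fin n → E} {G : M}
    (hG : ∀ i, D i G = G ^ 2 / 2 * algebraMap E M (γ₂ i) + G * algebraMap E M (γ₁ i) +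
      algebraMap E M (γ₀ i)) (ω : Fin n → E) (i j : Fin n) :
    tangentDer D (fun i => algebraMap E M (ω i)) i j G =
      algebraMap E M ((ω j * γ₂ i - ω i * γ₂ j) / 2) * G ^ 2 +
      algebraMap E M (ω j * γ₁ i - ω i * γ₁ j) * G + algebraMap E M (ω j * γ₀ i - ω i * γ₀ j) := by
  rw [tangentDer_apply, hG, hG]
  simp only [map_sub, map_mul, map_div₀, map_ofNat]
  ring

theorem tangentDer_affine {γ₁ γ₀ : Fin n → E} {G : M}
    (hG : ∀ i, D i G = G * algebraMap E M (γ₁ i) + algebraMap E M (γ₀ i)) (ω : Fin n → E)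
    (i j : Fin n) :
    tangentDer D (fun i => algebraMap E M (ω i)) i j G =
      algebraMap E M (ω j * γ₁ i - ω i * γ₁ j) * G + algebraMap E M (ω j * γ₀ i - ω i * γ₀ j) := by
  rw [tangentDer_apply, hG, hG]
  simp only [map_sub, map_mul]
  ring

theorem coeffs_eq_zero_of_transcendental {G : M} (hG : Transcendental E G) {a b c : E}
    (h : algebraMap E M a * G ^ 2 + algebraMap E M b * G + algebraMap E M c = 0) :
    a = 0 ∧ b = 0 ∧ c = 0 := by
  have h0 : (C a * X ^ 2 + C b * X + C c : E[X]) = 0 :=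
    (transcendental_iff.1 hG) _ (by simpa using h)
  refine ⟨?_, ?_, ?_⟩
  · simpa using congrArg (fun p => p.coeff 2) h0
  · simpa [coeff_X] using congrArg (fun p => p.coeff 1) h0
  · simpa using congrArg (fun p => p.coeff 0) h0

/-- The integrability conditions of a Riccati equation with a transcendental solution. -/
theorem riccati_integrability [CharZero E]
    (hD : ∀ i a, D i (algebraMap E M a) = algebraMap E M (δ i a))
    (hcomm : ∀ i j x, D i (D j x) = D j (D i x)) {G : M} (htr : Transcendental E G)
    {γ₂ γ₁ γ₀ : Fin n → E}
    (hG : ∀ i, D i G = G ^ 2 / 2 * algebraMap E M (γ₂ i) + G * algebraMap E M (γ₁ i) +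
      algebraMap E M (γ₀ i)) :
    dForm δ γ₂ = wedge γ₂ γ₁ ∧ dForm δ γ₁ = wedge γ₂ γ₀ ∧ dForm δ γ₀ = wedge γ₁ γ₀ := by
  have : CharZero M := charZero_of_injective_algebraMap (algebraMap E M).injective
  have hdiv : ∀ i, D i (G ^ 2 / 2) = G * D i G := fun i => by
    have : D i (2 : M) = 0 := (D i).map_natCast 2
    rw [Derivation.leibniz_div, this, pow_two G, Derivation.leibniz]
    simp only [smul_eq_mul]
    field_simp
    ring
  have key : ∀ i j, (dForm δ γ₂ i j - wedge γ₂ γ₁ i j) / 2 = 0 ∧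
      dForm δ γ₁ i j - wedge γ₂ γ₀ i j = 0 ∧ dForm δ γ₀ i j - wedge γ₁ γ₀ i j = 0 := by
    intro i j
    refine coeffs_eq_zero_of_transcendental htr ?_
    have h := hcomm i j G
    rw [hG j, hG i] at h
    simp only [map_add, Derivation.leibniz, smul_eq_mul, hdiv, hD] at h
    rw [hG j, hG i] at h
    simp only [dForm_apply, wedge_apply, map_sub, map_mul, map_div₀, map_ofNat]
    linear_combination h
  refine ⟨?_, ?_, ?_⟩ <;> ext i j
  · have := (key i j).1
    rw [div_eq_zero_iff] at this
    exact sub_eq_zero.1 (this.resolve_right two_ne_zero)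
  · exact sub_eq_zero.1 (key i j).2.1
  · exact sub_eq_zero.1 (key i j).2.2

/-- A pole at infinity of a solution: the leading coefficient yields a closed multiplier. -/
theorem isClosedMultiplier_of_pole [CharZero E]
    (hδ : ∀ i j x, δ i (δ j x) = δ j (δ i x))
    (hD : ∀ i a, D i (algebraMap E M a) = algebraMap E M (δ i a)) {G : M}
    (htr : Transcendental E G) {γ₁ γ₀ : Fin n → E}
    (hG : ∀ i, D i G = G * algebraMap E M (γ₁ i) + algebraMap E M (γ₀ i))
    (hγ₁ : dForm δ γ₁ = 0) {ω : Fin n → E} {k : ℕ} (hk : k ≠ 0) {θ : Fin n → Fin n → E}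
    {P Q : E[X]} (hQ : Q ≠ 0) (hPQ : Q.natDegree < P.natDegree)
    (hf : Solves D (fun i => algebraMap E M (ω i)) k (fun i j => algebraMap E M (θ i j))
      (aeval G P / aeval G Q)) :
    ∃ η, IsClosedMultiplier δ ω η := by
  have hP : P ≠ 0 := by rintro rfl; simp at hPQ
  refine ⟨_, isClosedMultiplier_of_homogeneous hδ hγ₁ (c := (P.natDegree : E) - Q.natDegree)
    (div_ne_zero (leadingCoeff_ne_zero.2 hP) (leadingCoeff_ne_zero.2 hQ))
    (fun i => by rw [map_sub, Derivation.map_natCast, Derivation.map_natCast, sub_zero]) hk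
    fun i j => ?_⟩
  exact leadingCoeff_relation (tangentDer_algebraMap hD ω i j) htr (tangentDer_affine hG ω i j) hQ
    (Or.inl hPQ) (hf.scalar hD i j)

/-- If `dG = γ`, then the leading coefficient at infinity of a solution of a homogeneous equation is
a solution of the same equation. -/
theorem Solves.descend_darboux
    (hD : ∀ i a, D i (algebraMap E M a) = algebraMap E M (δ i a)) {G : M}
    (htr : Transcendental E G) {γ : Fin n → E} (hG : ∀ i, D i G = algebraMap E M (γ i))
    {ω : Fin n → E} {k : ℕ} {P Q : E[X]} (hQ : Q ≠ 0)
    (hf : Solves D (fun i => algebraMap E M (ω i)) k 0 (aeval G P / aeval G Q)) :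
    Solves δ ω k 0 (P.leadingCoeff / Q.leadingCoeff) := by
  intro i j
  have h := Solves.scalar hD (θ := 0) (by simp only [Pi.zero_apply, map_zero]; exact hf) i j
  have := leadingCoeff_relation (tangentDer_algebraMap hD ω i j) htr
    (tangentDer_affine (γ₁ := 0) (γ₀ := γ) (by simpa using hG) ω i j) hQ (Or.inr rfl) h
  simpa using this

/-- The descent along a Liouville step: without a pole at infinity the value there is a solution;
otherwise the leading coefficient provides a closed multiplier. -/
theorem Solves.descend_liouville [CharZero E]
    (hδ : ∀ i j x, δ i (δ j x) = δ j (δ i x)) (hDc : ∀ i j x, D i (D j x) = D j (D i x))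
    (hD : ∀ i a, D i (algebraMap E M a) = algebraMap E M (δ i a)) {G : M}
    (htr : Transcendental E G) {γ₁ γ₀ : Fin n → E}
    (hG : ∀ i, D i G = G * algebraMap E M (γ₁ i) + algebraMap E M (γ₀ i))
    {ω w₁ : Fin n → E} (hω : ω ≠ 0) (hw : dForm δ ω = wedge ω w₁) {P Q : E[X]} (hQ : Q ≠ 0)
    (hf : Solves D (fun i => algebraMap E M (ω i)) 1
      (fun i j => algebraMap E M ((-dForm δ w₁) i j)) (aeval G P / aeval G Q)) :
    ∃ g, Solves δ ω 1 (-dForm δ w₁) g := by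
  rcases le_or_gt P.natDegree Q.natDegree with hle | hlt
  · exact ⟨_, fun i j => value_at_infinity_relation (tangentDer_algebraMap hD ω i j) htr
      (tangentDer_affine hG ω i j) hQ hle (hf.scalar hD i j)⟩
  · have hint := riccati_integrability (γ₂ := 0) hD hDc htr (by simpa using hG)
    have hγ₁ : dForm δ γ₁ = 0 := by rw [hint.2.1]; ext; simp [wedge]
    obtain ⟨η, hη⟩ := isClosedMultiplier_of_pole hδ hD htr hG hγ₁ one_ne_zero hQ hlt hf
    exact exists_solves_of_isClosedMultiplier hω hw hη

/-- If a solution has a pole at infinity, then infinity is invariant along the foliation. Either it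
is invariant in all directions, and there is a closed multiplier, or the coefficients of the
Riccati equation themselves are Godbillon–Vey data for a multiple of `ω`. -/
theorem exists_isProjectivePair_of_pole [CharZero E]
    (hδ : ∀ i j x, δ i (δ j x) = δ j (δ i x)) (hDc : ∀ i j x, D i (D j x) = D j (D i x))
    (hD : ∀ i a, D i (algebraMap E M a) = algebraMap E M (δ i a)) {G : M}
    (htr : Transcendental E G) {γ₂ γ₁ γ₀ : Fin n → E}
    (hG : ∀ i, D i G = G ^ 2 / 2 * algebraMap E M (γ₂ i) + G * algebraMap E M (γ₁ i) +
      algebraMap E M (γ₀ i))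
    {ω : Fin n → E} (hω : ω ≠ 0) {k : ℕ} (hk : k ≠ 0) {θ : Fin n → Fin n → E} {P Q : E[X]}
    (hQ : Q ≠ 0) (hPQ : Q.natDegree < P.natDegree)
    (hf : Solves D (fun i => algebraMap E M (ω i)) k (fun i j => algebraMap E M (θ i j))
      (aeval G P / aeval G Q)) :
    ∃ ω₁ ω₂, IsProjectivePair δ ω ω₁ ω₂ := by
  obtain ⟨h2, h1, h0⟩ := riccati_integrability hD hDc htr hG
  by_cases hγ : γ₂ = 0
  · subst hγ
    have hγ₁ : dForm δ γ₁ = 0 := by rw [h1]; ext; simp [wedge]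
    obtain ⟨η, hη⟩ := isClosedMultiplier_of_pole hδ hD htr (by simpa using hG) hγ₁ hk hQ hPQ hf
    exact ⟨η, 0, hη.isProjectivePair⟩
  · obtain ⟨μ, rfl⟩ := exists_smul_of_wedge_eq_zero (α := γ₂) hω (by
      ext i j
      have := quadratic_term_eq_zero (tangentDer_algebraMap hD ω i j) htr
        (tangentDer_riccati hG ω i j) hQ hPQ (hf.scalar hD i j)
      rw [div_eq_zero_iff] at this
      have := this.resolve_right two_ne_zero
      simp only [wedge_apply, Pi.zero_apply]
      linear_combination -this)
    have hμ : μ ≠ 0 := by rintro rfl; simp at hγ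
    exact ⟨_, _, IsProjectivePair.of_smul hμ hδ ⟨h2, h1, h0⟩⟩

end Step

/-! ### Descent along a Riccati step -/

section Riccati

variable {n : ℕ} {E M : Type*} [Field E] [Field M] [Algebra E M]
  {δ : Fin n → Derivation ℤ E E} {D : Fin n → Derivation ℤ M M}

theorem aeval_reflect_comp {G : M} {α : E} (hG : G - algebraMap E M α ≠ 0) {P : E[X]} {d : ℕ}
    (hP : P.natDegree ≤ d) :
    aeval (G - algebraMap E M α)⁻¹ (reflect d (P.comp (X + C α))) * (G - algebraMap E M α) ^ d =
      aeval G P := by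
  let : Invertible (G - algebraMap E M α) := invertibleOfNonzero hG
  have h := eval₂_reflect_mul_pow (algebraMap E M) (G - algebraMap E M α) d (P.comp (X + C α))
    (by rwa [natDegree_comp, natDegree_X_add_C, mul_one])
  rw [invOf_eq_inv, ← aeval_def, ← aeval_def] at h
  rw [h, aeval_comp]
  simp

/-- A pole at a point `α` of the projective line is moved to infinity by `u = 1 / (G - α)`. -/
theorem exists_isProjectivePair_of_root [CharZero E]
    (hδ : ∀ i j x, δ i (δ j x) = δ j (δ i x)) (hDc : ∀ i j x, D i (D j x) = D j (D i x))
    (hD : ∀ i a, D i (algebraMap E M a) = algebraMap E M (δ i a)) {G : M}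
    (htr : Transcendental E G) {γ₂ γ₁ γ₀ : Fin n → E}
    (hG : ∀ i, D i G = G ^ 2 / 2 * algebraMap E M (γ₂ i) + G * algebraMap E M (γ₁ i) +
      algebraMap E M (γ₀ i))
    {ω : Fin n → E} (hω : ω ≠ 0) {k : ℕ} (hk : k ≠ 0) {θ : Fin n → Fin n → E} {P Q : E[X]}
    (hQ : Q ≠ 0) (hPQ : P.natDegree ≤ Q.natDegree) {α : E} (hQα : Q.eval α = 0)
    (hPα : P.eval α ≠ 0)
    (hf : Solves D (fun i => algebraMap E M (ω i)) k (fun i j => algebraMap E M (θ i j))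
      (aeval G P / aeval G Q)) :
    ∃ ω₁ ω₂, IsProjectivePair δ ω ω₁ ω₂ := by
  have : CharZero M := charZero_of_injective_algebraMap (algebraMap E M).injective
  have hv : G - algebraMap E M α ≠ 0 := fun h =>
    htr (by rw [sub_eq_zero.1 h]; exact isAlgebraic_algebraMap α)
  set d := Q.natDegree with hd
  set u := (G - algebraMap E M α)⁻¹ with hu
  have hu0 : u ≠ 0 := inv_ne_zero hv
  have hGu : G = algebraMap E M α + u⁻¹ := by rw [hu, inv_inv]; ring
  have hutr : Transcendental E u := fun h => htr (by
    rw [hGu]; exact (isAlgebraic_algebraMap α).add h.inv)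
  -- `P'` and `Q'` are the numerator and the denominator in `u`, both multiplied by `u ^ d`
  set P' := reflect d (P.comp (X + C α)) with hP'
  set Q' := reflect d (Q.comp (X + C α)) with hQ'
  have hP'e : aeval u P' * (G - algebraMap E M α) ^ d = aeval G P := aeval_reflect_comp hv hPQ
  have hQ'e : aeval u Q' * (G - algebraMap E M α) ^ d = aeval G Q := aeval_reflect_comp hv le_rfl
  have hQ'0 : Q' ≠ 0 := by
    intro h0
    rw [h0, map_zero, zero_mul] at hQ'e
    exact hQ ((transcendental_iff.1 htr) Q hQ'e.symm)
  have hcoeff : ∀ R : E[X], (R.comp (X + C α)).coeff 0 = R.eval α := fun R => by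
    rw [coeff_zero_eq_eval_zero, eval_comp]; simp
  have hdpos : 0 < d := by
    rw [hd, Nat.pos_iff_ne_zero]
    intro h0
    rw [eq_C_of_natDegree_eq_zero h0, eval_C] at hQα
    exact hQ (by rw [eq_C_of_natDegree_eq_zero h0, hQα, C_0])
  -- the root `α` lowers the degree of `Q'` but not that of `P'`: there is a pole at `u = ∞`
  have hQ'deg : Q'.natDegree < d := by
    refine (natDegree_lt_iff_degree_lt hQ'0).2 ((degree_lt_iff_coeff_zero _ _).2 fun N hN => ?_)
    rw [hQ', coeff_reflect]
    rcases hN.eq_or_lt with rfl | hlt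
    · rw [revAt_le le_rfl, Nat.sub_self, hcoeff, hQα]
    · rw [revAt_eq_self_of_lt hlt]
      refine coeff_eq_zero_of_natDegree_lt ?_
      rwa [natDegree_comp, natDegree_X_add_C, mul_one]
  have hP'deg : d ≤ P'.natDegree := by
    refine le_natDegree_of_ne_zero ?_
    rwa [hP', coeff_reflect, revAt_le le_rfl, Nat.sub_self, hcoeff]
  have hfu : aeval G P / aeval G Q = aeval u P' / aeval u Q' := by
    rw [← hP'e, ← hQ'e, mul_div_mul_right _ _ (pow_ne_zero _ hv)]
  rw [hfu] at hf
  refine exists_isProjectivePair_of_pole hδ hDc hD hutr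
    (γ₂ := fun i => -(α ^ 2 * γ₂ i + 2 * α * γ₁ i + 2 * (γ₀ i - δ i α)))
    (γ₁ := fun i => -(α * γ₂ i + γ₁ i)) (γ₀ := fun i => -(γ₂ i / 2)) (fun i => ?_) hω hk hQ'0
    (hQ'deg.trans_le hP'deg) hf
  rw [hu, Derivation.leibniz_inv, map_sub, hD, hG i, ← hu, hGu]
  simp only [smul_eq_mul, map_neg, map_add, map_mul, map_sub, map_pow, map_div₀, map_ofNat]
  field_simp
  ring

section AlgebraicExtension

variable {Ec : Type*} [Field Ec] [Algebra E Ec] [Algebra.IsAlgebraic E Ec]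

/-- Compatible extensions of the derivations to algebraic extensions of `E` and of `M`. -/
theorem exists_derivations_of_isAlgebraic [CharZero E] {Mc : Type*} [Field Mc] [Algebra M Mc]
    [Algebra E Mc] [Algebra Ec Mc] [IsScalarTower E Ec Mc] [IsScalarTower E M Mc]
    [Algebra.IsAlgebraic M Mc]
    (hδ : ∀ i j x, δ i (δ j x) = δ j (δ i x)) (hDc : ∀ i j x, D i (D j x) = D j (D i x))
    (hD : ∀ i a, D i (algebraMap E M a) = algebraMap E M (δ i a)) :
    ∃ (δ' : Fin n → Derivation ℤ Ec Ec) (D' : Fin n → Derivation ℤ Mc Mc),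
      (∀ i j x, δ' i (δ' j x) = δ' j (δ' i x)) ∧ (∀ i j x, D' i (D' j x) = D' j (D' i x)) ∧
      (∀ i a, δ' i (algebraMap E Ec a) = algebraMap E Ec (δ i a)) ∧
      (∀ i a, D' i (algebraMap M Mc a) = algebraMap M Mc (D i a)) ∧
      ∀ i a, D' i (algebraMap Ec Mc a) = algebraMap Ec Mc (δ' i a) := by
  have : CharZero M := charZero_of_injective_algebraMap (algebraMap E M).injective
  have : Algebra.FormallyEtale M Mc := Algebra.FormallyEtale.of_isSeparable _ _
  have : Algebra.FormallyEtale E Ec := Algebra.FormallyEtale.of_isSeparable _ _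
  choose δ' hδ' using fun i => exists_derivation_extension (B := Ec) (δ i)
  choose D' hD' using fun i => exists_derivation_extension (B := Mc) (D i)
  refine ⟨δ', D', fun i j => comm_of_formallyUnramified (hδ' i) (hδ' j) (hδ i j),
    fun i j => comm_of_formallyUnramified (hD' i) (hD' j) (hDc i j), hδ', hD', fun i a => ?_⟩
  have h0 := derivation_eq_zero_of_formallyUnramified (A := E)
    ((D' i).compAlgebraMap Ec - (Algebra.linearMap Ec Mc).compDer (δ' i)) (fun a => by
      rw [Derivation.sub_apply, sub_eq_zero]
      change D' i (algebraMap Ec Mc (algebraMap E Ec a)) =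
        algebraMap Ec Mc (δ' i (algebraMap E Ec a))
      rw [hδ', ← IsScalarTower.algebraMap_apply, ← IsScalarTower.algebraMap_apply,
        IsScalarTower.algebraMap_apply E M Mc, hD', hD, ← IsScalarTower.algebraMap_apply])
  exact sub_eq_zero.1 (congrArg (fun T => T a) h0)

/-- A solution with a pole at a point `α` algebraic over `E` gives a solution in `E`. -/
theorem Solves.descend_riccati_of_root [CharZero E]
    (hδ : ∀ i j x, δ i (δ j x) = δ j (δ i x)) (hDc : ∀ i j x, D i (D j x) = D j (D i x))
    (hD : ∀ i a, D i (algebraMap E M a) = algebraMap E M (δ i a)) {G : M}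
    (htr : Transcendental E G) {γ₂ γ₁ γ₀ : Fin n → E}
    (hG : ∀ i, D i G = G ^ 2 / 2 * algebraMap E M (γ₂ i) + G * algebraMap E M (γ₁ i) +
      algebraMap E M (γ₀ i))
    {ω w₁ w₂ : Fin n → E} (hω : ω ≠ 0) (hw₁ : dForm δ ω = wedge ω w₁)
    (hw₂ : dForm δ w₁ = wedge ω w₂) {P Q : E[X]} (hQ : Q ≠ 0) (hPQ : IsCoprime P Q)
    (hle : P.natDegree ≤ Q.natDegree) {α : Ec} (hα : aeval α Q = 0) (Mc : Type*) [Field Mc]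
    [Algebra M Mc] [Algebra E Mc] [Algebra Ec Mc] [IsScalarTower E Ec Mc] [IsScalarTower E M Mc]
    [Algebra.IsAlgebraic M Mc]
    (hf : Solves D (fun i => algebraMap E M (ω i)) 2
      (fun i j => algebraMap E M ((wedge w₁ w₂ - dForm δ w₂) i j)) (aeval G P / aeval G Q)) :
    ∃ g, Solves δ ω 2 (wedge w₁ w₂ - dForm δ w₂) g := by
  obtain ⟨δ', D', hδ'c, hD'c, hδ', hD', hD'δ'⟩ :=
    exists_derivations_of_isAlgebraic (Ec := Ec) (Mc := Mc) hδ hDc hD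
  have : CharZero Ec := charZero_of_injective_algebraMap (algebraMap E Ec).injective
  have hinj := (algebraMap E Ec).injective
  have hω' : (fun i => algebraMap E Ec (ω i)) ≠ 0 := fun h0 =>
    hω (funext fun i => hinj ((congrFun h0 i).trans (map_zero _).symm))
  have hPα : aeval α P ≠ 0 := by
    intro h
    obtain ⟨a, b, hab⟩ := hPQ
    have := congrArg (aeval α) hab
    simp [h, hα] at this
  have hcompat : ∀ a : E, algebraMap Ec Mc (algebraMap E Ec a) =
      algebraMap M Mc (algebraMap E M a) := fun a => by
    rw [← IsScalarTower.algebraMap_apply, ← IsScalarTower.algebraMap_apply]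
  have htr' : Transcendental Ec (algebraMap M Mc G) := fun h =>
    htr ((isAlgebraic_algebraMap_iff (algebraMap M Mc).injective).1 (h.restrictScalars E))
  have haev : ∀ R : E[X], aeval (algebraMap M Mc G) (R.map (algebraMap E Ec)) =
      algebraMap M Mc (aeval G R) := fun R => by
    rw [aeval_map_algebraMap, aeval_algebraMap_apply]
  have hf' := (solves_algebraMap_iff hD').2 hf
  rw [map_div₀, ← haev, ← haev] at hf'
  simp only [← hcompat] at hf'
  obtain ⟨ω₁, ω₂, h⟩ := exists_isProjectivePair_of_root (ω := fun i => algebraMap E Ec (ω i))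
    (θ := fun i j => algebraMap E Ec ((wedge w₁ w₂ - dForm δ w₂) i j))
    (γ₂ := fun i => algebraMap E Ec (γ₂ i)) (γ₁ := fun i => algebraMap E Ec (γ₁ i))
    (γ₀ := fun i => algebraMap E Ec (γ₀ i)) hδ'c hD'c hD'δ' htr' (fun i => by
      rw [hD', hG]
      simp only [hcompat, map_add, map_mul, map_div₀, map_pow, map_ofNat]) hω' two_ne_zero
    ((Polynomial.map_ne_zero_iff hinj).2 hQ) (by rwa [natDegree_map, natDegree_map])
    (by rwa [eval_map_algebraMap]) (by rwa [eval_map_algebraMap]) hf'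
  obtain ⟨g, hg⟩ := exists_solves_of_isProjectivePair (w₁ := fun i => algebraMap E Ec (w₁ i))
    (w₂ := fun i => algebraMap E Ec (w₂ i)) hδ'c hω'
    (by
      ext i j
      rw [dForm_algebraMap hδ', hw₁]
      simp [wedge_apply])
    (by
      ext i j
      rw [dForm_algebraMap hδ', hw₂]
      simp [wedge_apply]) h
  refine Solves.descend_of_isAlgebraic hδ' (Algebra.IsAlgebraic.isAlgebraic g) (k := 2)
    (θ := wedge w₁ w₂ - dForm δ w₂) fun i j => ?_
  rw [hg i j]
  simp only [Pi.sub_apply, dForm_algebraMap hδ', wedge_apply, map_sub, map_mul]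

end AlgebraicExtension

/-- The descent along a Riccati step: a pole, at infinity or at a point algebraic over `E`, provides
Godbillon–Vey data; a rational expression without poles belongs to `E`. -/
theorem Solves.descend_riccati [CharZero E]
    (hδ : ∀ i j x, δ i (δ j x) = δ j (δ i x)) (hDc : ∀ i j x, D i (D j x) = D j (D i x))
    (hD : ∀ i a, D i (algebraMap E M a) = algebraMap E M (δ i a)) {G : M}
    (htr : Transcendental E G) {γ₂ γ₁ γ₀ : Fin n → E}
    (hG : ∀ i, D i G = G ^ 2 / 2 * algebraMap E M (γ₂ i) + G * algebraMap E M (γ₁ i) +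
      algebraMap E M (γ₀ i))
    {ω w₁ w₂ : Fin n → E} (hω : ω ≠ 0) (hw₁ : dForm δ ω = wedge ω w₁)
    (hw₂ : dForm δ w₁ = wedge ω w₂) {P Q : E[X]} (hQ : Q ≠ 0) (hPQ : IsCoprime P Q)
    (hf : Solves D (fun i => algebraMap E M (ω i)) 2
      (fun i j => algebraMap E M ((wedge w₁ w₂ - dForm δ w₂) i j)) (aeval G P / aeval G Q)) :
    ∃ g, Solves δ ω 2 (wedge w₁ w₂ - dForm δ w₂) g := by
  rcases lt_or_ge Q.natDegree P.natDegree with hlt | hle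
  · obtain ⟨ω₁, ω₂, h⟩ := exists_isProjectivePair_of_pole hδ hDc hD htr hG hω two_ne_zero hQ hlt hf
    exact exists_solves_of_isProjectivePair hδ hω hw₁ hw₂ h
  rcases Nat.eq_zero_or_pos Q.natDegree with h0 | hpos
  · refine ⟨P.coeff 0 / Q.coeff 0, (solves_algebraMap_iff hD).1 ?_⟩
    rw [eq_C_of_natDegree_eq_zero h0, eq_C_of_natDegree_le_zero (hle.trans h0.le), aeval_C, aeval_C,
      ← map_div₀] at hf
    exact hf
  obtain ⟨α, hα⟩ := IsAlgClosed.exists_aeval_eq_zero (AlgebraicClosure M) Q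
    (fun h => hpos.ne' (natDegree_eq_of_degree_eq_some h))
  let β : algebraicClosure E (AlgebraicClosure M) := ⟨α, mem_algebraicClosure_iff.2 ⟨Q, hQ, hα⟩⟩
  have hβ : aeval β Q = 0 := by
    refine (algebraMap _ (AlgebraicClosure M)).injective ?_
    rw [← aeval_algebraMap_apply, map_zero]
    exact hα
  exact hf.descend_riccati_of_root hδ hDc hD htr hG hω hw₁ hw₂ hQ hPQ hle hβ (AlgebraicClosure M)

theorem exists_isCoprime_aeval_div_aeval (G : M) (R S : E[X]) :
    ∃ P Q : E[X], Q ≠ 0 ∧ IsCoprime P Q ∧ aeval G R / aeval G S = aeval G P / aeval G Q := by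
  rcases eq_or_ne (aeval G S) 0 with hS | hS
  · exact ⟨0, 1, one_ne_zero, isCoprime_one_right, by simp [hS]⟩
  have hS0 : S ≠ 0 := by rintro rfl; simp at hS
  let : GCDMonoid E[X] := UniqueFactorizationMonoid.toGCDMonoid E[X]
  have hd : gcd R S ≠ 0 := gcd_ne_zero_of_right hS0
  have hR' := EuclideanDomain.mul_div_cancel' hd (gcd_dvd_left R S)
  have hS' := EuclideanDomain.mul_div_cancel' hd (gcd_dvd_right R S)
  refine ⟨R / gcd R S, S / gcd R S, ?_, isCoprime_div_gcd_div_gcd hS0, ?_⟩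
  · intro h
    rw [h, mul_zero] at hS'
    exact hS0 hS'.symm
  · have hRe : aeval G R = aeval G (gcd R S) * aeval G (R / gcd R S) := by rw [← map_mul, hR']
    have hSe : aeval G S = aeval G (gcd R S) * aeval G (S / gcd R S) := by rw [← map_mul, hS']
    rw [hSe] at hS
    rw [hRe, hSe]
    exact mul_div_mul_left _ _ (left_ne_zero_of_mul hS)

end Riccati

/-! ### Descent along a tower of differential extensions -/

section Tower

variable {n : ℕ} {L : Type*} [Field L] [Algebra (MerGerm n) L] {D : Fin n → Derivation ℤ L L}

/-- The restriction of a derivation to a stable intermediate field. -/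
def restrictDer (D : Derivation ℤ L L) (E : IntermediateField (MerGerm n) L)
    (h : ∀ x ∈ E, D x ∈ E) : Derivation ℤ E E :=
  Derivation.mk' (AddMonoidHom.mk' (fun x : E => (⟨D x, h x x.2⟩ : E))
      (fun x y => Subtype.ext (D.map_add x y))).toIntLinearMap
    (fun x y => Subtype.ext (D.leibniz x y))

theorem algebraMap_restrictDer (D : Derivation ℤ L L) (E : IntermediateField (MerGerm n) L)
    (h : ∀ x ∈ E, D x ∈ E) (a : E) :
    D (algebraMap E L a) = algebraMap E L (restrictDer D E h a) := rfl

theorem restrictDer_algebraMap (hext : IsDifferentialExtension D)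
    (E : IntermediateField (MerGerm n) L) (i : Fin n) (h : ∀ x ∈ E, D i x ∈ E) (a : MerGerm n) :
    restrictDer (D i) E h (algebraMap (MerGerm n) E a) =
      algebraMap (MerGerm n) E (merPartial i a) :=
  Subtype.ext (hext.extends_partial i a)

theorem restrictDer_comm (hext : IsDifferentialExtension D) (E : IntermediateField (MerGerm n) L)
    (h : ∀ i, ∀ x ∈ E, D i x ∈ E) (i j : Fin n) (x : E) :
    restrictDer (D i) E (h i) (restrictDer (D j) E (h j) x) =
      restrictDer (D j) E (h j) (restrictDer (D i) E (h i) x) :=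
  Subtype.ext (hext.comm i j x)

/-- Induction from the top of a tower to its base. An adjunction of an element that is algebraic over
the previous field counts as an algebraic step. -/
theorem IsTower.descend {step : IntermediateField (MerGerm n) L → L → Prop} (hT : IsTower D step)
    {p : IntermediateField (MerGerm n) L → Prop} (htop : p ⊤)
    (halg : ∀ E E' : IntermediateField (MerGerm n) L, (∀ i, ∀ x ∈ E, D i x ∈ E) →
      (∀ x ∈ E', IsAlgebraic E x) → p E' → p E)
    (htr : ∀ (E : IntermediateField (MerGerm n) L) (G : L), (∀ i, ∀ x ∈ E, D i x ∈ E) →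
      step E G → Transcendental E G →
      p ((IntermediateField.adjoin E {G}).restrictScalars (MerGerm n)) → p E) : p ⊥ := by
  obtain ⟨m, E, h0, hm, hst, hstep⟩ := hT
  have key : ∀ j ≤ m, p (E (m - j)) := by
    intro j
    induction j with
    | zero => intro _; rwa [Nat.sub_zero, hm]
    | succ j ih =>
      intro hj
      have hp := ih (by omega)
      have hs : ∀ i, ∀ x ∈ E (m - (j + 1)), D i x ∈ E (m - (j + 1)) := hst _ (by omega)
      rw [show m - j = m - (j + 1) + 1 by omega] at hp
      rcases (hstep (m - (j + 1)) (by omega)).2 with ha | ⟨G, hG, hE⟩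
      · exact halg _ _ hs ha hp
      · by_cases hGa : IsAlgebraic (E (m - (j + 1))) G
        · refine halg _ _ hs (fun x hx => ?_) hp
          rw [hE] at hx
          have := IntermediateField.isAlgebraic_adjoin_simple hGa.isIntegral
          exact (IntermediateField.isAlgebraic_iff.1
            (Algebra.IsAlgebraic.isAlgebraic (R := E (m - (j + 1)))
              (⟨x, hx⟩ : IntermediateField.adjoin (E (m - (j + 1))) {G})))
        · exact htr _ G hs hG hGa (hE ▸ hp)
  have := key m le_rfl
  rwa [Nat.sub_self, h0] at this

theorem exists_rational_expression {E : IntermediateField (MerGerm n) L} {G x : L}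
    (hx : x ∈ (IntermediateField.adjoin E {G}).restrictScalars (MerGerm n)) :
    ∃ P Q : E[X], Q ≠ 0 ∧ IsCoprime P Q ∧ x = aeval G P / aeval G Q := by
  obtain ⟨R, S, rfl⟩ := (IntermediateField.mem_adjoin_simple_iff E x).1 hx
  exact exists_isCoprime_aeval_div_aeval G R S

/-- The equation `df ∧ ω + k f dω = θ` over the differential extension `L`, for data `ω` and `θ`
over the field of germs of meromorphic functions. -/
abbrev SolvesIn (D : Fin n → Derivation ℤ L L) (ω : Fin n → MerGerm n) (k : ℕ)
    (θ : Fin n → Fin n → MerGerm n) (f : L) : Prop :=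
  Solves D (fun i => algebraMap (MerGerm n) L (ω i)) k
    (fun i j => algebraMap (MerGerm n) L (θ i j)) f

/-- A descent statement for a linear equation along one step extends to a tower, the algebraic
steps being always possible. -/
theorem IsTower.descend_solves [CharZero L] {step : IntermediateField (MerGerm n) L → L → Prop}
    (hext : IsDifferentialExtension D) (hT : IsTower D step) {ω : Fin n → MerGerm n} {k : ℕ}
    {θ : Fin n → Fin n → MerGerm n} {f : L} (hf : SolvesIn D ω k θ f)
    (htr : ∀ (E : IntermediateField (MerGerm n) L) (hE : ∀ i, ∀ x ∈ E, D i x ∈ E) (G : L)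
      (P Q : E[X]), step E G → Transcendental E G → Q ≠ 0 → IsCoprime P Q →
      SolvesIn D ω k θ (aeval G P / aeval G Q) →
      ∃ g, SolvesIn (fun i => restrictDer (D i) E (hE i)) ω k θ g) :
    ∃ g, Solves merPartial ω k θ g := by
  have up : ∀ (E : IntermediateField (MerGerm n) L) (hE : ∀ i, ∀ x ∈ E, D i x ∈ E),
      (∃ g, SolvesIn (fun i => restrictDer (D i) E (hE i)) ω k θ g) →
        ∃ g ∈ E, SolvesIn D ω k θ g := by
    rintro E hE ⟨g, hg⟩
    exact ⟨g, g.2, (solves_algebraMap_iff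
      (fun i => algebraMap_restrictDer (D i) E (hE i))).2 hg⟩
  have h := hT.descend (p := fun E => ∃ g ∈ E, SolvesIn D ω k θ g)
    ⟨f, IntermediateField.mem_top, hf⟩ ?_ ?_
  · obtain ⟨g, hg, hs⟩ := h
    obtain ⟨a, rfl⟩ := IntermediateField.mem_bot.1 hg
    exact ⟨a, (solves_algebraMap_iff hext.extends_partial).1 hs⟩
  · rintro E E' hE ha ⟨g, hg, hs⟩
    exact up E hE (Solves.descend_of_isAlgebraic
      (fun i => algebraMap_restrictDer (D i) E (hE i)) (ha g hg) hs)
  · rintro E G hE hstep hG ⟨g, hg, hs⟩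
    obtain ⟨P, Q, hQ, hPQ, rfl⟩ := exists_rational_expression hg
    exact up E hE (htr E hE G P Q hstep hG hQ hPQ hs)

theorem IsTower.descend_liouville [CharZero L] (hext : IsDifferentialExtension D)
    (hT : IsTower D (LiouvilleStep D)) {ω w₁ : Fin n → MerGerm n} (hω : ω ≠ 0)
    (hw : dForm merPartial ω = wedge ω w₁) {f : L}
    (hf : SolvesIn D ω 1 (-dForm merPartial w₁) f) :
    ∃ g, Solves merPartial ω 1 (-dForm merPartial w₁) g := by
  refine hT.descend_solves hext hf fun E hE G P Q hstep hG hQ _ hs => ?_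
  obtain ⟨γ₁, γ₀, h₁, h₀, hdG⟩ := hstep
  have hδ := fun i => restrictDer_algebraMap hext E i (hE i)
  have hθ : (fun i j => algebraMap (MerGerm n) E ((-dForm merPartial w₁) i j)) =
      -dForm (fun i => restrictDer (D i) E (hE i)) (fun i => algebraMap (MerGerm n) E (w₁ i)) := by
    ext i j
    simp only [Pi.neg_apply, dForm_algebraMap hδ, map_neg]
  unfold SolvesIn
  rw [hθ]
  refine Solves.descend_liouville (P := P) (Q := Q) (G := G) (γ₁ := fun i => ⟨γ₁ i, h₁ i⟩)
    (γ₀ := fun i => ⟨γ₀ i, h₀ i⟩) (restrictDer_comm hext E hE) hext.comm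
    (fun i => algebraMap_restrictDer (D i) E (hE i)) hG (fun i => congrFun hdG i) ?_ ?_ hQ ?_
  · exact fun h0 => hω (funext fun i =>
      (algebraMap (MerGerm n) E).injective ((congrFun h0 i).trans (map_zero _).symm))
  · ext i j
    rw [dForm_algebraMap hδ, hw]
    simp [wedge_apply]
  · rw [← hθ]
    exact hs

theorem IsTower.descend_riccati [CharZero L] (hext : IsDifferentialExtension D)
    (hT : IsTower D (RiccatiStep D)) {ω w₁ w₂ : Fin n → MerGerm n} (hω : ω ≠ 0)
    (hw₁ : dForm merPartial ω = wedge ω w₁) (hw₂ : dForm merPartial w₁ = wedge ω w₂) {f : L}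
    (hf : SolvesIn D ω 2 (wedge w₁ w₂ - dForm merPartial w₂) f) :
    ∃ g, Solves merPartial ω 2 (wedge w₁ w₂ - dForm merPartial w₂) g := by
  refine hT.descend_solves hext hf fun E hE G P Q hstep hG hQ hPQ hs => ?_
  obtain ⟨γ₂, γ₁, γ₀, h₂, h₁, h₀, hdG⟩ := hstep
  have hδ := fun i => restrictDer_algebraMap hext E i (hE i)
  have hθ : (fun i j => algebraMap (MerGerm n) E ((wedge w₁ w₂ - dForm merPartial w₂) i j)) =
      wedge (fun i => algebraMap (MerGerm n) E (w₁ i)) (fun i => algebraMap (MerGerm n) E (w₂ i)) -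
      dForm (fun i => restrictDer (D i) E (hE i)) (fun i => algebraMap (MerGerm n) E (w₂ i)) := by
    ext i j
    simp only [Pi.sub_apply, dForm_algebraMap hδ, wedge_apply, map_sub, map_mul]
  unfold SolvesIn
  rw [hθ]
  refine Solves.descend_riccati (P := P) (Q := Q) (G := G) (γ₂ := fun i => ⟨γ₂ i, h₂ i⟩)
    (γ₁ := fun i => ⟨γ₁ i, h₁ i⟩) (γ₀ := fun i => ⟨γ₀ i, h₀ i⟩) (restrictDer_comm hext E hE)
    hext.comm (fun i => algebraMap_restrictDer (D i) E (hE i)) hG (fun i => congrFun hdG i)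
    ?_ ?_ ?_ hQ hPQ ?_
  · exact fun h0 => hω (funext fun i =>
      (algebraMap (MerGerm n) E).injective ((congrFun h0 i).trans (map_zero _).symm))
  · ext i j
    rw [dForm_algebraMap hδ, hw₁]
    simp [wedge_apply]
  · ext i j
    rw [dForm_algebraMap hδ, hw₂]
    simp [wedge_apply]
  · rw [← hθ]
    exact hs

/-- The weight may change along an algebraic step, so it is quantified together with the solution. -/
theorem IsTower.descend_darboux (hext : IsDifferentialExtension D)
    (hT : IsTower D (DarbouxStep D)) {ω : Fin n → MerGerm n} {f : L} (hne : f ≠ 0)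
    (hf : SolvesIn D ω 1 0 f) :
    ∃ (F : MerGerm n) (k : ℕ), F ≠ 0 ∧ 1 ≤ k ∧ Solves merPartial ω k 0 F := by
  have hzero : ∀ (F : Type _) [Field F] [Algebra (MerGerm n) F],
      (fun i j => algebraMap (MerGerm n) F ((0 : Fin n → Fin n → MerGerm n) i j)) = 0 := by
    intros; ext; simp
  have h := hT.descend (p := fun E => ∃ g ∈ E, ∃ k, g ≠ 0 ∧ 1 ≤ k ∧ SolvesIn D ω k 0 g)
    ⟨f, IntermediateField.mem_top, 1, hne, le_rfl, hf⟩ ?_ ?_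
  · obtain ⟨g, hg, k, hg0, hk, hs⟩ := h
    obtain ⟨a, rfl⟩ := IntermediateField.mem_bot.1 hg
    exact ⟨a, k, fun h => hg0 (by rw [h]; exact map_zero (algebraMap (MerGerm n) L)), hk,
      (solves_algebraMap_iff hext.extends_partial).1 hs⟩
  · rintro E E' hE ha ⟨g, hg, k, hg0, hk, hs⟩
    rw [SolvesIn, hzero] at hs
    obtain ⟨F, l, hF, hl, hFs⟩ := Solves.descend_homogeneous_of_isAlgebraic
      (ω := fun i => algebraMap (MerGerm n) E (ω i))
      (fun i => algebraMap_restrictDer (D i) E (hE i)) hk hg0 (ha g hg) hs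
    rw [← hzero E] at hFs
    exact ⟨F, F.2, l, fun h => hF (Subtype.ext h), hl, (solves_algebraMap_iff
      (fun i => algebraMap_restrictDer (D i) E (hE i))).2 hFs⟩
  · rintro E G hE ⟨γ, hγ, hdG⟩ hG ⟨g, hg, k, hg0, hk, hs⟩
    obtain ⟨P, Q, hQ, -, rfl⟩ := exists_rational_expression hg
    have hP : P ≠ 0 := by rintro rfl; simp at hg0
    rw [SolvesIn, hzero] at hs
    have hFs := Solves.descend_darboux (ω := fun i => algebraMap (MerGerm n) E (ω i))
      (fun i => algebraMap_restrictDer (D i) E (hE i)) (γ := fun i => ⟨γ i, hγ i⟩) hG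
      (fun i => congrFun hdG i) hQ hs
    rw [← hzero E] at hFs
    refine ⟨_, (P.leadingCoeff / Q.leadingCoeff).2, k, fun h => ?_, hk, (solves_algebraMap_iff
      (fun i => algebraMap_restrictDer (D i) E (hE i))).2 hFs⟩
    exact div_ne_zero (leadingCoeff_ne_zero.2 hP) (leadingCoeff_ne_zero.2 hQ) (Subtype.ext h)

end Tower

/-! ### Adjoining a solution of an integrable Riccati equation -/

section Adjoin

variable {n : ℕ}

theorem derivation_eq_zero_of_C_of_X {E : Type*} [Field E] (d : Derivation ℤ E[X] E[X])
    (hC : ∀ a, d (C a) = 0) (hX : d X = 0) (p : E[X]) : d p = 0 := by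
  induction p using Polynomial.induction_on' with
  | add p q hp hq => rw [map_add, hp, hq, add_zero]
  | monomial k a =>
    rw [← C_mul_X_pow_eq_monomial, d.leibniz, d.leibniz_pow, hC, hX]
    simp

/-- Commuting derivations of `E` extend to commuting derivations of the field `F = E(X)` of rational
functions with `X` a solution of a prescribed integrable Riccati equation. -/
theorem exists_rational_derivations {E : Type*} [Field E] [CharZero E] (F : Type*) [Field F]
    [Algebra E[X] F] [IsFractionRing E[X] F] [Algebra E F] [IsScalarTower E E[X] F]
    {δ : Fin n → Derivation ℤ E E} (hδ : ∀ i j x, δ i (δ j x) = δ j (δ i x))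
    {γ₂ γ₁ γ₀ : Fin n → E} (h2 : dForm δ γ₂ = wedge γ₂ γ₁) (h1 : dForm δ γ₁ = wedge γ₂ γ₀)
    (h0 : dForm δ γ₀ = wedge γ₁ γ₀) :
    ∃ D : Fin n → Derivation ℤ F F,
      (∀ i j x, D i (D j x) = D j (D i x)) ∧
      (∀ i a, D i (algebraMap E F a) = algebraMap E F (δ i a)) ∧
      ∀ i, D i (algebraMap E[X] F X) = algebraMap E[X] F X ^ 2 / 2 * algebraMap E F (γ₂ i) +
        algebraMap E[X] F X * algebraMap E F (γ₁ i) + algebraMap E F (γ₀ i) := by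
  have : Algebra.FormallyEtale E[X] F :=
    Algebra.FormallyEtale.of_isLocalization (nonZeroDivisors E[X])
  obtain ⟨h, hh⟩ : ∃ h : E, h = 2⁻¹ := ⟨_, rfl⟩
  set v : Fin n → E[X] := fun i => C h * C (γ₂ i) * X ^ 2 + C (γ₁ i) * X + C (γ₀ i) with hv
  set d : Fin n → Derivation ℤ E[X] E[X] := fun i => polyDer (δ i) (v i) with hd
  have hdC : ∀ i a, d i (C a) = C (δ i a) := fun i a => polyDer_C _ _ _
  have hdX : ∀ i, d i X = v i := fun i => polyDer_X _ _
  have h2' := fun i j => congrFun (congrFun h2 i) j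
  have h1' := fun i j => congrFun (congrFun h1 i) j
  have h0' := fun i j => congrFun (congrFun h0 i) j
  simp only [dForm_apply, wedge_apply] at h2' h1' h0'
  have hdd : ∀ i j p, d i (d j p) = d j (d i p) := by
    intro i j p
    have hδh : ∀ i, δ i h = 0 := fun i => by
      have : δ i (2 : E) = 0 := (δ i).map_natCast 2
      rw [hh, Derivation.leibniz_inv, this, smul_zero]
    have hX2 : ∀ i, d i (X ^ 2) = 2 * X * v i := fun i => by
      rw [pow_two, Derivation.leibniz, hdX, smul_eq_mul]; ring
    rw [← sub_eq_zero, ← Derivation.commutator_apply]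
    refine derivation_eq_zero_of_C_of_X _ (fun a => ?_) ?_ p
    · rw [Derivation.commutator_apply, hdC, hdC, hdC, hdC, hδ, sub_self]
    · rw [Derivation.commutator_apply, hdX, hdX]
      have e2 : C (δ i (γ₂ j)) - C (δ j (γ₂ i)) = C (γ₂ i) * C (γ₁ j) - C (γ₂ j) * C (γ₁ i) := by
        simp only [← C_sub, ← C_mul, h2']
      have e1 : C (δ i (γ₁ j)) - C (δ j (γ₁ i)) = C (γ₂ i) * C (γ₀ j) - C (γ₂ j) * C (γ₀ i) := by
        simp only [← C_sub, ← C_mul, h1']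
      have e0 : C (δ i (γ₀ j)) - C (δ j (γ₀ i)) = C (γ₁ i) * C (γ₀ j) - C (γ₁ j) * C (γ₀ i) := by
        simp only [← C_sub, ← C_mul, h0']
      have hC2 : C h * 2 = 1 := by
        rw [show (2 : E[X]) = C 2 from rfl, ← C_mul, hh, inv_mul_cancel₀ two_ne_zero, C_1]
      simp only [hv, map_add, Derivation.leibniz, smul_eq_mul, hdC, hX2, hdX, hδh, C_0]
      linear_combination C h * X ^ 2 * e2 + X * e1 + e0 +
        X * (C (γ₂ j) * C (γ₀ i) - C (γ₂ i) * C (γ₀ j)) * hC2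
  choose D hD using fun i => exists_derivation_extension (B := F) (d i)
  have hCF : ∀ a : E, algebraMap E[X] F (C a) = algebraMap E F a := fun a =>
    (IsScalarTower.algebraMap_apply E E[X] F a).symm
  refine ⟨D, fun i j => comm_of_formallyUnramified (hD i) (hD j) (hdd i j), fun i a => ?_,
    fun i => ?_⟩
  · have := (hD i (C a)).trans (congrArg (algebraMap E[X] F) (hdC i a))
    rwa [hCF, hCF] at this
  · have := (hD i X).trans (congrArg (algebraMap E[X] F) (hdX i))
    rw [this]
    simp only [hv, map_add, map_mul, hCF, map_pow, hh, map_inv₀, map_ofNat]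
    ring

end Adjoin

section Extend

variable {n : ℕ} {L L' : Type*} [Field L] [Algebra (MerGerm n) L] [Field L']
  [Algebra (MerGerm n) L'] {D : Fin n → Derivation ℤ L L} {D' : Fin n → Derivation ℤ L' L'}

theorem isAlgebraic_map (ι : L →ₐ[MerGerm n] L') {E : IntermediateField (MerGerm n) L} {x : L}
    (hx : IsAlgebraic E x) : IsAlgebraic (E.map ι) (ι x) := by
  obtain ⟨p, hp, hpx⟩ := hx
  refine ⟨p.map (E.equivMap ι : E →+* E.map ι), ?_, ?_⟩
  · exact (Polynomial.map_ne_zero_iff (E.equivMap ι).injective).2 hp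
  · rw [aeval_def, eval₂_map]
    have : (algebraMap (E.map ι) L').comp (E.equivMap ι : E →+* E.map ι) =
        (ι : L →+* L').comp (algebraMap E L) := by ext; rfl
    rw [this]
    change eval₂ ((ι : L →+* L').comp (algebraMap E L)) ((ι : L →+* L') x) p = 0
    rw [← hom_eval₂, ← aeval_def, hpx, map_zero]

/-- The relation between consecutive fields of a tower. -/
def IsTowerStep (step : IntermediateField (MerGerm n) L → L → Prop)
    (A B : IntermediateField (MerGerm n) L) : Prop :=
  A ≤ B ∧ ((∀ x ∈ B, IsAlgebraic A x) ∨
    ∃ G : L, step A G ∧ B = (IntermediateField.adjoin A {G}).restrictScalars (MerGerm n))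

theorem IsTowerStep.map (ι : L →ₐ[MerGerm n] L')
    {step : IntermediateField (MerGerm n) L → L → Prop}
    {step' : IntermediateField (MerGerm n) L' → L' → Prop}
    (hstep : ∀ E G, step E G → step' (E.map ι) (ι G)) {A B : IntermediateField (MerGerm n) L}
    (h : IsTowerStep step A B) : IsTowerStep step' (A.map ι) (B.map ι) := by
  refine ⟨IntermediateField.map_mono ι h.1, ?_⟩
  rcases h.2 with ha | ⟨g, hg, hE⟩
  · left
    rintro _ ⟨y, hy, rfl⟩
    exact isAlgebraic_map ι (ha y hy)
  · right
    refine ⟨ι g, hstep _ _ hg, ?_⟩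
    rw [hE, IntermediateField.restrictScalars_adjoin, IntermediateField.restrictScalars_adjoin,
      IntermediateField.adjoin_map, Set.image_union, Set.image_singleton]
    rfl

/-- A tower is prolonged by the adjunction of one more element. -/
theorem IsTower.extend (ι : L →ₐ[MerGerm n] L') (hι : ∀ i x, D' i (ι x) = ι (D i x))
    {step : IntermediateField (MerGerm n) L → L → Prop}
    {step' : IntermediateField (MerGerm n) L' → L' → Prop}
    (hstep : ∀ E G, step E G → step' (E.map ι) (ι G)) (hT : IsTower D step) {G : L'}
    (hG : step' ι.fieldRange G)
    (htop : (IntermediateField.adjoin ι.fieldRange {G}).restrictScalars (MerGerm n) = ⊤) :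
    IsTower D' step' := by
  obtain ⟨m, E, h0, hm, hst, hs⟩ := hT
  obtain ⟨E', hE', hE'top⟩ : ∃ E' : ℕ → IntermediateField (MerGerm n) L',
      (∀ i ≤ m, E' i = (E i).map ι) ∧ E' (m + 1) = ⊤ :=
    ⟨fun i => if i ≤ m then (E i).map ι else ⊤, fun i hi => if_pos hi, if_neg (by omega)⟩
  refine ⟨m + 1, E', ?_, hE'top, ?_, ?_⟩
  · rw [hE' 0 (Nat.zero_le _), h0, IntermediateField.map_bot]
  · intro i hi j x hx
    rcases Nat.le_succ_iff.1 hi with hi | rfl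
    · rw [hE' i hi] at hx ⊢
      obtain ⟨y, hy, rfl⟩ := hx
      exact ⟨D j y, hst i hi j y hy, (hι j y).symm⟩
    · rw [Nat.succ_eq_add_one, hE'top]
      exact IntermediateField.mem_top
  · intro i hi
    change IsTowerStep step' (E' i) (E' (i + 1))
    rcases Nat.lt_succ_iff_lt_or_eq.1 hi with hlt | rfl
    · rw [hE' i hlt.le, hE' (i + 1) hlt]
      exact IsTowerStep.map ι hstep (hs i hlt)
    · rw [hE' i le_rfl, hm, ← AlgHom.fieldRange_eq_map, hE'top]
      exact ⟨le_top, Or.inr ⟨G, hG, htop.symm⟩⟩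

theorem adjoin_X_eq_top {F : Type*} [Field F] [Algebra L[X] F] [IsFractionRing L[X] F]
    [Algebra L F] [IsScalarTower L L[X] F] [Algebra (MerGerm n) F] (ι : L →ₐ[MerGerm n] F)
    (hι : ∀ x, ι x = algebraMap L F x) :
    (IntermediateField.adjoin ι.fieldRange {algebraMap L[X] F X}).restrictScalars
      (MerGerm n) = ⊤ := by
  rw [eq_top_iff]
  intro x _
  rw [IntermediateField.mem_restrictScalars]
  have hp : ∀ p : L[X], algebraMap L[X] F p ∈
      IntermediateField.adjoin ι.fieldRange {algebraMap L[X] F X} := by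
    intro p
    induction p using Polynomial.induction_on' with
    | add p q hp hq => rw [map_add]; exact add_mem hp hq
    | monomial k a =>
      rw [← C_mul_X_pow_eq_monomial, map_mul, map_pow]
      refine mul_mem ?_ (pow_mem (IntermediateField.mem_adjoin_simple_self _ _) k)
      rw [show algebraMap L[X] F (C a) = ι a by
        rw [hι]; exact (IsScalarTower.algebraMap_apply L L[X] F a).symm]
      exact IntermediateField.algebraMap_mem _ (⟨ι a, a, rfl⟩ : ι.fieldRange)
  obtain ⟨p, q, -, rfl⟩ := IsFractionRing.div_surjective (A := L[X]) x
  exact div_mem (hp p) (hp q)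

end Extend

/-! ### The field of germs of meromorphic functions as a differential field -/

/-- The second derivative of an analytic function is symmetric. -/
theorem holPartial_comm {n : ℕ} (i j : Fin n) (g : HolGerm n) :
    holPartial i (holPartial j g) = holPartial j (holPartial i g) := by
  obtain ⟨_, f, hf, rfl⟩ := g
  refine Subtype.ext (Germ.coe_eq.2 ?_)
  filter_upwards [hf.eventually_analyticAt] with z hz
  have hd : DifferentiableAt ℂ (fderiv ℂ f) z := hz.fderiv.differentiableAt
  have hsymm : IsSymmSndFDerivAt ℂ f z := hz.contDiffAt.isSymmSndFDerivAt (n := ⊤) (by simp)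
  have key : ∀ v w : Fin n → ℂ,
      fderiv ℂ (fun z => fderiv ℂ f z v) z w = fderiv ℂ (fderiv ℂ f) z w v := fun v w => by
    rw [fderiv_clm_apply hd (differentiableAt_const v)]
    simp
  change fderiv ℂ (fun z => fderiv ℂ f z (Pi.single j 1)) z (Pi.single i 1) =
    fderiv ℂ (fun z => fderiv ℂ f z (Pi.single i 1)) z (Pi.single j 1)
  rw [key, key]
  exact hsymm _ _

theorem merPartial_comm {n : ℕ} (i j : Fin n) (x : MerGerm n) :
    merPartial i (merPartial j x) = merPartial j (merPartial i x) :=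
  have : Algebra.FormallyUnramified (HolGerm n) (MerGerm n) :=
    Algebra.FormallyUnramified.of_isLocalization (nonZeroDivisors (HolGerm n))
  comm_of_formallyUnramified (merPartial_algebraMap i) (merPartial_algebraMap j)
    (holPartial_comm i j) x

instance instCharZeroMerGerm (n : ℕ) : CharZero (MerGerm n) := by
  have : CharZero (HolGerm n) := by
    refine ⟨fun a b h => ?_⟩
    have h' : ((fun _ => (a : ℂ) : (Fin n → ℂ) → ℂ) : Germ (𝓝 (0 : Fin n → ℂ)) ℂ) =
        ((fun _ => (b : ℂ) : (Fin n → ℂ) → ℂ) : Germ (𝓝 (0 : Fin n → ℂ)) ℂ) :=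
      congrArg Subtype.val h
    obtain ⟨z, hz⟩ := (Germ.coe_eq.1 h').exists
    exact Nat.cast_injective (R := ℂ) hz
  exact charZero_of_injective_algebraMap (IsFractionRing.injective (HolGerm n) (MerGerm n))

theorem toMer_ne_zero {n : ℕ} {ω : Fin n → HolGerm n} (hω : ω ≠ 0) : toMer ω ≠ 0 := fun h =>
  hω (funext fun i => IsFractionRing.injective (HolGerm n) (MerGerm n)
    ((congrFun h i).trans (map_zero _).symm))

theorem isDifferentialExtension_merPartial (n : ℕ) :
    IsDifferentialExtension (L := MerGerm n) merPartial where
  comm := merPartial_comm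
  extends_partial _ _ := rfl

/-! ### Godbillon–Vey sequences of length two and three -/

section GodbillonVey

variable {n : ℕ} {ω : Fin n → HolGerm n}

theorem wedge_self {E : Type*} [Field E] (α : Fin n → E) : wedge α α = 0 := by
  ext i j
  simp only [wedge_apply, Pi.zero_apply]
  ring

theorem wedge_zero {E : Type*} [Field E] (α : Fin n → E) : wedge α 0 = 0 := by
  ext i j
  simp [wedge_apply]

theorem zero_wedge {E : Type*} [Field E] (α : Fin n → E) : wedge 0 α = 0 := by
  ext i j
  simp [wedge_apply]

theorem hasGodbillonVeyOfLength_three_iff : HasGodbillonVeyOfLength ω 3 ↔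
    ∃ ω₁ ω₂, IsProjectivePair merPartial (toMer ω) ω₁ ω₂ := by
  constructor
  · rintro ⟨Ω, ⟨h0, h⟩, hl⟩
    refine ⟨Ω 1, Ω 2, ?_, ?_, ?_⟩
    · have := h 0
      simpa [h0] using this
    · have := h 1
      simpa [wedge_self] using this
    · have := h 2
      rw [hl 3 le_rfl, wedge_zero, zero_add, show Finset.Icc 1 2 = {1, 2} from rfl] at this
      rw [this]
      ext i j
      simp [wedge_apply]
      ring
  · rintro ⟨ω₁, ω₂, h⟩
    let Ω : ℕ → Fin n → MerGerm n := fun k =>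
      if k = 0 then toMer ω else if k = 1 then ω₁ else if k = 2 then ω₂ else 0
    have hΩ0 : Ω 0 = toMer ω := rfl
    have hΩ1 : Ω 1 = ω₁ := rfl
    have hΩ2 : Ω 2 = ω₂ := rfl
    have hΩ : ∀ k, 3 ≤ k → Ω k = 0 := fun k hk => by
      simp only [Ω]
      rw [if_neg (by omega), if_neg (by omega), if_neg (by omega)]
    refine ⟨Ω, ⟨hΩ0, fun m => ?_⟩, hΩ⟩
    rcases lt_or_ge m 3 with hm | hm
    · interval_cases m
      · simpa [hΩ0, hΩ1] using h.d_zero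
      · simpa [hΩ1, hΩ2, wedge_self] using h.d_one
      · rw [hΩ 3 le_rfl, wedge_zero, zero_add, show Finset.Icc 1 2 = {1, 2} from rfl, hΩ2, h.d_two]
        ext i j
        simp [wedge_apply, hΩ1, hΩ2]
        ring
    -- the two indices in a term have sum `m + 1 ≥ 4`: one exceeds `2` or both are equal to `2`
    · rw [hΩ m hm, hΩ (m + 1) (by omega), wedge_zero, zero_add, Finset.sum_eq_zero]
      · ext i j
        simp [dForm]
      · intro k hk
        rw [Finset.mem_Icc] at hk
        rcases lt_or_ge k 3 with hk3 | hk3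
        · rcases lt_or_ge (m - k + 1) 3 with hk' | hk'
          · rw [show m - k + 1 = 2 by omega, show k = 2 by omega, wedge_self, smul_zero]
          · rw [hΩ _ hk', wedge_zero, smul_zero]
        · rw [hΩ _ hk3, zero_wedge, smul_zero]

theorem hasGodbillonVeyOfLength_two_iff : HasGodbillonVeyOfLength ω 2 ↔
    ∃ η, IsClosedMultiplier merPartial (toMer ω) η := by
  constructor
  · rintro ⟨Ω, ⟨h0, h⟩, hl⟩
    refine ⟨Ω 1, ?_, ?_⟩
    · have := h 0
      simpa [h0] using this
    · have := h 1
      simpa [wedge_self, hl 2 le_rfl, wedge_zero] using this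
  · rintro ⟨η, h⟩
    let Ω : ℕ → Fin n → MerGerm n := fun k => if k = 0 then toMer ω else if k = 1 then η else 0
    have hΩ0 : Ω 0 = toMer ω := rfl
    have hΩ1 : Ω 1 = η := rfl
    have hΩ : ∀ k, 2 ≤ k → Ω k = 0 := fun k hk => by
      simp only [Ω]
      rw [if_neg (by omega), if_neg (by omega)]
    refine ⟨Ω, ⟨hΩ0, fun m => ?_⟩, hΩ⟩
    rcases lt_or_ge m 2 with hm | hm
    · interval_cases m
      · simpa [hΩ0, hΩ1] using h.d_zero
      · simpa [hΩ1, hΩ 2 le_rfl, wedge_self, wedge_zero] using h.closed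
    · rw [hΩ m hm, hΩ (m + 1) (by omega), wedge_zero, zero_add, Finset.sum_eq_zero]
      · ext i j
        simp [dForm]
      · intro k hk
        rw [Finset.mem_Icc] at hk
        rcases lt_or_ge k 2 with hk2 | hk2
        · rw [hΩ (m - k + 1) (by omega), wedge_zero, smul_zero]
        · rw [hΩ _ hk2, zero_wedge, smul_zero]

end GodbillonVey

/-! ### From first integrals to Godbillon–Vey sequences -/

section FirstIntegral

variable {n : ℕ} {L : Type*} [Field L] [Algebra (MerGerm n) L] {D : Fin n → Derivation ℤ L L}
  {ω : Fin n → HolGerm n}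

theorem toExt_ne_zero (hω : ω ≠ 0) : toExt L ω ≠ 0 := fun h =>
  toMer_ne_zero hω (funext fun i =>
    (algebraMap (MerGerm n) L).injective ((congrFun h i).trans (map_zero _).symm))

/-- The equation of weight one says that `Φ` is an integrating factor. -/
theorem dForm_smul_eq_zero_iff {E : Type*} [Field E] {D : Fin n → Derivation ℤ E E} {α : Fin n → E}
    {Φ : E} : dForm D (Φ • α) = 0 ↔ Solves D α 1 0 Φ := by
  have : ∀ i j, dForm D (Φ • α) i j = tangentDer D α i j Φ + (1 : ℕ) * dForm D α i j * Φ := by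
    intro i j
    simp only [dForm_apply, tangentDer_apply, Pi.smul_apply, smul_eq_mul, Derivation.leibniz,
      Nat.cast_one]
    ring
  constructor
  · intro h i j
    rw [← this, h]
  · intro h
    ext i j
    rw [this, h i j]

/-- An integrating factor raised to the power `k` is a solution of weight `k`. -/
theorem solves_pow_iff {E : Type*} [Field E] [CharZero E] {D : Fin n → Derivation ℤ E E}
    {α : Fin n → E} {Φ : E} (hΦ : Φ ≠ 0) {k : ℕ} (hk : 1 ≤ k) :
    Solves D α k 0 (Φ ^ k) ↔ Solves D α 1 0 Φ := by
  refine forall_congr' fun i => forall_congr' fun j => ?_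
  have hk0 : (k : E) ≠ 0 := Nat.cast_ne_zero.2 (by omega)
  have hpow : Φ ^ k = Φ ^ (k - 1) * Φ := by rw [← pow_succ, Nat.sub_add_cancel hk]
  have : tangentDer D α i j (Φ ^ k) + k * dForm D α i j * Φ ^ k =
      k * Φ ^ (k - 1) * (tangentDer D α i j Φ + (1 : ℕ) * dForm D α i j * Φ) := by
    rw [Derivation.leibniz_pow, nsmul_eq_mul, smul_eq_mul, hpow]
    push_cast
    ring
  simp only [Pi.zero_apply]
  rw [this, mul_eq_zero, or_iff_right (mul_ne_zero hk0 (pow_ne_zero _ hΦ))]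

/-- The quotient `dH / ω` is an integrating factor. -/
theorem IsFirstIntegral.exists_integrating_factor (hext : IsDifferentialExtension D) (hω : ω ≠ 0)
    {H : L} (hH : IsFirstIntegral D ω H) : ∃ a : L, a ≠ 0 ∧ Solves D (toExt L ω) 1 0 a := by
  obtain ⟨a, ha⟩ := exists_smul_of_wedge_eq_zero (α := dFun D H) (toExt_ne_zero (L := L) hω) (by
    ext i j
    have := congrFun (congrFun hH.2 i) j
    simp only [wedge_apply, Pi.zero_apply] at this ⊢
    linear_combination -this)
  refine ⟨a, fun h => hH.1 (by rw [ha, h, zero_smul]), dForm_smul_eq_zero_iff.1 ?_⟩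
  rw [← ha]
  ext i j
  simp only [dForm_apply, dFun, Pi.zero_apply]
  rw [hext.comm i j, sub_self]

theorem IsFirstIntegral.exists_isClosedMultiplier [CharZero L] (hext : IsDifferentialExtension D)
    (hω : ω ≠ 0) {H : L} (hH : IsFirstIntegral D ω H) :
    ∃ η, IsClosedMultiplier D (toExt L ω) η := by
  obtain ⟨a, ha, hs⟩ := hH.exists_integrating_factor hext hω
  refine ⟨_, isClosedMultiplier_of_homogeneous (β := 0) (c := 0) hext.comm (by ext; simp [dForm])
    ha (fun i => map_zero _) one_ne_zero fun i j => ?_⟩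
  simpa using hs i j

theorem dForm_toExt (hext : IsDifferentialExtension D) {w : Fin n → MerGerm n}
    (hw : dForm merPartial (toMer ω) = wedge (toMer ω) w) :
    dForm D (toExt L ω) = wedge (toExt L ω) (fun i => algebraMap (MerGerm n) L (w i)) := by
  ext i j
  have := dForm_algebraMap hext.extends_partial (toMer ω) i j
  rw [hw] at this
  refine this.trans ?_
  simp [wedge_apply, toExt]

end FirstIntegral

theorem HasLiouvilleFirstIntegral.hasGodbillonVeyOfLength {n : ℕ} {ω : Fin n → HolGerm n}
    (hω : ω ≠ 0) (hint : IsIntegrable ω) (h : HasLiouvilleFirstIntegral ω) :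
    HasGodbillonVeyOfLength ω 2 := by
  obtain ⟨L, _, _, D, hext, hT, H, hH⟩ := h
  have : CharZero L := charZero_of_injective_algebraMap (algebraMap (MerGerm n) L).injective
  obtain ⟨w₁, w₂, hw₁, hw₂⟩ := exists_godbillonVey_start merPartial_comm (toMer_ne_zero hω) hint
  obtain ⟨η, hη⟩ := hH.exists_isClosedMultiplier hext hω
  obtain ⟨f, hf⟩ := exists_solves_of_isClosedMultiplier (toExt_ne_zero hω) (dForm_toExt hext hw₁) hη
  obtain ⟨g, hg⟩ := hT.descend_liouville hext (toMer_ne_zero hω) hw₁ (f := f) (fun i j => by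
    refine (hf i j).trans ?_
    simp only [Pi.neg_apply, map_neg, dForm_algebraMap hext.extends_partial])
  exact hasGodbillonVeyOfLength_two_iff.2 ⟨_, hg.isClosedMultiplier hw₁⟩

theorem HasRiccatiFirstIntegral.hasGodbillonVeyOfLength {n : ℕ} {ω : Fin n → HolGerm n}
    (hω : ω ≠ 0) (hint : IsIntegrable ω) (h : HasRiccatiFirstIntegral ω) :
    HasGodbillonVeyOfLength ω 3 := by
  obtain ⟨L, _, _, D, hext, hT, H, hH⟩ := h
  have : CharZero L := charZero_of_injective_algebraMap (algebraMap (MerGerm n) L).injective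
  obtain ⟨w₁, w₂, hw₁, hw₂⟩ := exists_godbillonVey_start merPartial_comm (toMer_ne_zero hω) hint
  obtain ⟨η, hη⟩ := hH.exists_isClosedMultiplier hext hω
  have hw₂' : dForm D (fun i => algebraMap (MerGerm n) L (w₁ i)) =
      wedge (toExt L ω) (fun i => algebraMap (MerGerm n) L (w₂ i)) := by
    ext i j
    rw [dForm_algebraMap hext.extends_partial, hw₂]
    simp [wedge_apply, toExt]
  obtain ⟨f, hf⟩ := exists_solves_of_isProjectivePair hext.comm (toExt_ne_zero hω)
    (dForm_toExt hext hw₁) hw₂' hη.isProjectivePair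
  obtain ⟨g, hg⟩ := hT.descend_riccati hext (toMer_ne_zero hω) hw₁ hw₂ (f := f) (fun i j => by
    refine (hf i j).trans ?_
    simp only [Pi.sub_apply, map_sub, dForm_algebraMap hext.extends_partial, wedge_apply, map_mul])
  exact hasGodbillonVeyOfLength_three_iff.2 ⟨_, _, hg.isProjectivePair hw₁ hw₂⟩

/-- A `k`-th root of a germ of meromorphic function exists in the algebraic closure, which is a
differential extension. -/
theorem exists_root_of_solves {n : ℕ} {ω : Fin n → HolGerm n} {F : MerGerm n} {k : ℕ} (hF : F ≠ 0)
    (hk : 1 ≤ k) (hs : Solves merPartial (toMer ω) k 0 F) (A : Type*) [Field A]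
    [Algebra (MerGerm n) A] [IsAlgClosed A] [Algebra.IsAlgebraic (MerGerm n) A] :
    ∃ D : Fin n → Derivation ℤ A A, IsDifferentialExtension D ∧
      ∃ Φ : A, Φ ≠ 0 ∧ Φ ^ k = algebraMap (MerGerm n) A F ∧ dForm D (Φ • toExt A ω) = 0 := by
  have : CharZero A := charZero_of_injective_algebraMap (algebraMap (MerGerm n) A).injective
  have : Algebra.FormallyEtale (MerGerm n) A := Algebra.FormallyEtale.of_isSeparable _ _
  choose D hD using fun i => exists_derivation_extension (B := A) (merPartial (n := n) i)
  have hext : IsDifferentialExtension D :=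
    ⟨fun i j => comm_of_formallyUnramified (hD i) (hD j) (merPartial_comm i j), hD⟩
  obtain ⟨Φ, hΦ⟩ := IsAlgClosed.exists_pow_nat_eq (algebraMap (MerGerm n) A F) hk
  have hΦ0 : Φ ≠ 0 := by
    rintro rfl
    rw [zero_pow (by omega)] at hΦ
    exact hF ((algebraMap (MerGerm n) A).injective (hΦ.symm.trans (map_zero _).symm))
  refine ⟨D, hext, Φ, hΦ0, hΦ, dForm_smul_eq_zero_iff.2 ((solves_pow_iff hΦ0 hk).1 ?_)⟩
  rw [hΦ]
  exact fun i j => ((solves_algebraMap_iff (M := A) hD).2 hs i j).trans (map_zero _)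

theorem HasDarbouxFirstIntegral.hasGodbillonVeyOfLengthOne {n : ℕ} {ω : Fin n → HolGerm n}
    (hω : ω ≠ 0) (h : HasDarbouxFirstIntegral ω) : HasGodbillonVeyOfLengthOne ω := by
  obtain ⟨L, _, _, D, hext, hT, H, hH⟩ := h
  obtain ⟨a, ha, hs⟩ := hH.exists_integrating_factor hext hω
  obtain ⟨F, k, hF, hk, hFs⟩ := hT.descend_darboux hext (ω := toMer ω) ha (fun i j => by
    refine (hs i j).trans ?_
    simp)
  obtain ⟨D', hext', Φ, -, hΦ, hd⟩ := exists_root_of_solves hF hk hFs (AlgebraicClosure (MerGerm n))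
  exact ⟨F, k, hF, hk, _, inferInstance, inferInstance, D', hext', Φ, hΦ, hd⟩

theorem HasGodbillonVeyOfLengthOne.exists_solves {n : ℕ} {ω : Fin n → HolGerm n}
    (h : HasGodbillonVeyOfLengthOne ω) :
    ∃ (F : MerGerm n) (k : ℕ), F ≠ 0 ∧ 1 ≤ k ∧ Solves merPartial (toMer ω) k 0 F := by
  obtain ⟨F, k, hF, hk, L, _, _, D, hext, Φ, hΦ, hd⟩ := h
  have : CharZero L := charZero_of_injective_algebraMap (algebraMap (MerGerm n) L).injective
  have hΦ0 : Φ ≠ 0 := by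
    rintro rfl
    rw [zero_pow (by omega)] at hΦ
    exact hF ((algebraMap (MerGerm n) L).injective (hΦ.symm.trans (map_zero _).symm))
  have hs := (solves_pow_iff hΦ0 hk).2 (dForm_smul_eq_zero_iff.1 hd)
  rw [hΦ] at hs
  refine ⟨F, k, hF, hk, (solves_algebraMap_iff hext.extends_partial).1 fun i j => ?_⟩
  refine (hs i j).trans ?_
  simp

/-! ### From Godbillon–Vey sequences to first integrals -/

section Construction

variable {n : ℕ}

/-- A kind of step in a tower of differential extensions, such as the Darboux, Liouville and Riccati
steps, for all differential extensions at once. -/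
def StepKind (n : ℕ) : Type 1 :=
  ∀ (F : Type) [Field F] [Algebra (MerGerm n) F], (Fin n → Derivation ℤ F F) →
    IntermediateField (MerGerm n) F → F → Prop

/-- Steps of the given kind are preserved by embeddings of differential extensions. -/
def StepKind.IsFunctorial (S : StepKind n) : Prop :=
  ∀ (L L' : Type) [Field L] [Field L'] [Algebra (MerGerm n) L] [Algebra (MerGerm n) L']
    (D : Fin n → Derivation ℤ L L) (D' : Fin n → Derivation ℤ L' L') (ι : L →ₐ[MerGerm n] L'),
    (∀ i x, D' i (ι x) = ι (D i x)) → ∀ E G, S L D E G → S L' D' (E.map ι) (ι G)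

theorem isFunctorial_darboux :
    StepKind.IsFunctorial (n := n) fun _ _ _ D => DarbouxStep D := by
  rintro L L' _ _ _ _ D D' ι hι E G ⟨γ, hγ, h⟩
  refine ⟨fun i => ι (γ i), fun i => ⟨_, hγ i, rfl⟩, funext fun i => ?_⟩
  rw [dFun, hι, ← h]
  rfl

theorem isFunctorial_liouville :
    StepKind.IsFunctorial (n := n) fun _ _ _ D => LiouvilleStep D := by
  rintro L L' _ _ _ _ D D' ι hι E G ⟨γ₁, γ₀, h₁, h₀, h⟩
  refine ⟨fun i => ι (γ₁ i), fun i => ι (γ₀ i), fun i => ⟨_, h₁ i, rfl⟩, fun i => ⟨_, h₀ i, rfl⟩,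
    funext fun i => ?_⟩
  have := congrArg ι (congrFun h i)
  simp only [dFun, Pi.add_apply, Pi.smul_apply, smul_eq_mul, map_add, map_mul] at this ⊢
  rw [hι, this]

theorem isFunctorial_riccati :
    StepKind.IsFunctorial (n := n) fun _ _ _ D => RiccatiStep D := by
  rintro L L' _ _ _ _ D D' ι hι E G ⟨γ₂, γ₁, γ₀, h₂, h₁, h₀, h⟩
  refine ⟨fun i => ι (γ₂ i), fun i => ι (γ₁ i), fun i => ι (γ₀ i), fun i => ⟨_, h₂ i, rfl⟩,
    fun i => ⟨_, h₁ i, rfl⟩, fun i => ⟨_, h₀ i, rfl⟩, funext fun i => ?_⟩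
  have := congrArg ι (congrFun h i)
  simp only [dFun, Pi.add_apply, Pi.smul_apply, smul_eq_mul, map_add, map_mul, map_div₀, map_pow,
    map_ofNat] at this ⊢
  rw [hι, this]

/-- A step that solves the Riccati equation with coefficients `γ₂`, `γ₁`, `γ₀` is of kind `S`. -/
def StepKind.Admits (S : StepKind n) {L : Type} [Field L] [Algebra (MerGerm n) L]
    (γ₂ γ₁ γ₀ : Fin n → L) : Prop :=
  ∀ (F : Type) [Field F] [Algebra (MerGerm n) F] (D : Fin n → Derivation ℤ F F)
    (ι : L →ₐ[MerGerm n] F) (G : F),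
    (∀ i, D i G = G ^ 2 / 2 * ι (γ₂ i) + G * ι (γ₁ i) + ι (γ₀ i)) → S F D ι.fieldRange G

/-- The data of a tower of kind `S` with top field `L`. -/
structure IsExtensionOfKind (S : StepKind n) {L : Type} [Field L] [Algebra (MerGerm n) L]
    (D : Fin n → Derivation ℤ L L) : Prop where
  isDifferentialExtension : IsDifferentialExtension D
  isTower : IsTower D (S L D)

theorem IsExtensionOfKind.adjoin_of_isFractionRing {S : StepKind n} (hS : S.IsFunctorial)
    {L : Type} [Field L] [Algebra (MerGerm n) L] {D : Fin n → Derivation ℤ L L}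
    (h : IsExtensionOfKind S D) {γ₂ γ₁ γ₀ : Fin n → L} (h2 : dForm D γ₂ = wedge γ₂ γ₁)
    (h1 : dForm D γ₁ = wedge γ₂ γ₀) (h0 : dForm D γ₀ = wedge γ₁ γ₀) (hSγ : S.Admits γ₂ γ₁ γ₀)
    (F : Type) [Field F] [Algebra L[X] F] [IsFractionRing L[X] F] [Algebra L F]
    [IsScalarTower L L[X] F] [Algebra (MerGerm n) F] [IsScalarTower (MerGerm n) L F] :
    ∃ (D' : Fin n → Derivation ℤ F F) (G : F), IsExtensionOfKind S D' ∧ G ≠ 0 ∧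
      (∀ i x, D' i (algebraMap L F x) = algebraMap L F (D i x)) ∧
      ∀ i, D' i G = G ^ 2 / 2 * algebraMap L F (γ₂ i) + G * algebraMap L F (γ₁ i) +
        algebraMap L F (γ₀ i) := by
  have : CharZero L := charZero_of_injective_algebraMap (algebraMap (MerGerm n) L).injective
  obtain ⟨D', hcomm, hD', hG⟩ :=
    exists_rational_derivations F h.isDifferentialExtension.comm h2 h1 h0
  refine ⟨D', algebraMap L[X] F X, ⟨⟨hcomm, fun i f => ?_⟩, ?_⟩, ?_, hD', hG⟩
  · rw [IsScalarTower.algebraMap_apply (MerGerm n) L F, hD',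
      h.isDifferentialExtension.extends_partial, ← IsScalarTower.algebraMap_apply]
  · exact h.isTower.extend (IsScalarTower.toAlgHom (MerGerm n) L F) hD'
      (hS L F D D' (IsScalarTower.toAlgHom (MerGerm n) L F) hD')
      (hSγ F D' (IsScalarTower.toAlgHom (MerGerm n) L F) _ hG)
      (adjoin_X_eq_top _ fun _ => rfl)
  · exact fun hX => X_ne_zero (IsFractionRing.injective L[X] F (hX.trans (map_zero _).symm))

/-- A nonzero solution of an integrable Riccati equation can be adjoined to a tower. -/
theorem IsExtensionOfKind.adjoin {S : StepKind n} (hS : S.IsFunctorial)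
    {L : Type} [Field L] [Algebra (MerGerm n) L] {D : Fin n → Derivation ℤ L L}
    (h : IsExtensionOfKind S D) {γ₂ γ₁ γ₀ : Fin n → L} (h2 : dForm D γ₂ = wedge γ₂ γ₁)
    (h1 : dForm D γ₁ = wedge γ₂ γ₀) (h0 : dForm D γ₀ = wedge γ₁ γ₀) (hSγ : S.Admits γ₂ γ₁ γ₀) :
    ∃ (F : Type) (_ : Field F) (_ : Algebra (MerGerm n) F) (_ : Algebra L F)
      (_ : IsScalarTower (MerGerm n) L F) (D' : Fin n → Derivation ℤ F F) (G : F),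
      IsExtensionOfKind S D' ∧ G ≠ 0 ∧
      (∀ i x, D' i (algebraMap L F x) = algebraMap L F (D i x)) ∧
      ∀ i, D' i G = G ^ 2 / 2 * algebraMap L F (γ₂ i) + G * algebraMap L F (γ₁ i) +
        algebraMap L F (γ₀ i) := by
  obtain ⟨D', G, h'⟩ := h.adjoin_of_isFractionRing hS h2 h1 h0 hSγ (RatFunc L)
  exact ⟨RatFunc L, inferInstance, inferInstance, inferInstance, inferInstance, D', G, h'⟩

theorem isExtensionOfKind_merPartial (S : StepKind n) :
    IsExtensionOfKind S (L := MerGerm n) merPartial where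
  isDifferentialExtension := isDifferentialExtension_merPartial n
  isTower := by
    have hbot : (⊥ : IntermediateField (MerGerm n) (MerGerm n)) = ⊤ :=
      eq_top_iff.2 fun x _ => IntermediateField.mem_bot.2 ⟨x, rfl⟩
    exact ⟨0, fun _ => ⊥, rfl, hbot, fun _ _ _ _ _ => hbot ▸ IntermediateField.mem_top,
      fun i hi => absurd hi (Nat.not_lt_zero i)⟩

theorem isExtensionOfKind_of_isAlgebraic (S : StepKind n) {A : Type} [Field A]
    [Algebra (MerGerm n) A] [Algebra.IsAlgebraic (MerGerm n) A] {D : Fin n → Derivation ℤ A A}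
    (hext : IsDifferentialExtension D) : IsExtensionOfKind S D where
  isDifferentialExtension := hext
  isTower := by
    refine ⟨1, fun i => if i = 0 then ⊥ else ⊤, rfl, rfl, fun i _ j x hx => ?_, fun i hi => ?_⟩
    · rcases eq_or_ne i 0 with rfl | hi
      · obtain ⟨a, rfl⟩ := IntermediateField.mem_bot.1 hx
        exact IntermediateField.mem_bot.2 ⟨merPartial j a, (hext.extends_partial j a).symm⟩
      · simp only [if_neg hi, IntermediateField.mem_top]
    · obtain rfl : i = 0 := by omega
      refine ⟨bot_le, Or.inl fun x _ => ?_⟩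
      exact (Algebra.IsAlgebraic.isAlgebraic (R := MerGerm n) x).tower_top _

theorem toExt_eq_algebraMap {L F : Type*} [Field L] [Field F] [Algebra (MerGerm n) L]
    [Algebra (MerGerm n) F] [Algebra L F] [IsScalarTower (MerGerm n) L F]
    (ω : Fin n → HolGerm n) (i : Fin n) : toExt F ω i = algebraMap L F (toExt L ω i) :=
  IsScalarTower.algebraMap_apply (MerGerm n) L F _

theorem dForm_zero {E : Type*} [Field E] (δ : Fin n → Derivation ℤ E E) : dForm δ 0 = 0 := by
  ext i j
  simp [dForm]

/-- A primitive of the closed form `Φ ω` is a first integral. -/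
theorem exists_firstIntegral_of_integrating_factor {S : StepKind n} (hS : S.IsFunctorial)
    {ω : Fin n → HolGerm n} (hω : ω ≠ 0) {L : Type} [Field L] [Algebra (MerGerm n) L]
    {D : Fin n → Derivation ℤ L L} (h : IsExtensionOfKind S D) {Φ : L} (hΦ : Φ ≠ 0)
    (hd : dForm D (Φ • toExt L ω) = 0) (hSω : S.Admits 0 0 (Φ • toExt L ω)) :
    ∃ (F : Type) (_ : Field F) (_ : Algebra (MerGerm n) F) (D' : Fin n → Derivation ℤ F F),
      IsDifferentialExtension D' ∧ IsTower D' (S F D') ∧ ∃ H : F, IsFirstIntegral D' ω H := by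
  obtain ⟨F, _, _, _, _, D', G, hK, -, -, hG⟩ := h.adjoin hS (γ₂ := 0) (γ₁ := 0)
    (by rw [dForm_zero, wedge_zero]) (by rw [dForm_zero, zero_wedge]) (by rw [hd, zero_wedge]) hSω
  have hdG : dFun D' G = algebraMap L F Φ • toExt F ω := by
    ext i
    rw [dFun, hG, Pi.zero_apply, map_zero, mul_zero, mul_zero, zero_add, zero_add, Pi.smul_apply,
      smul_eq_mul, map_mul, ← toExt_eq_algebraMap]
    rfl
  refine ⟨F, _, _, D', hK.isDifferentialExtension, hK.isTower, G, ?_, ?_⟩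
  · rw [hdG]
    exact smul_ne_zero (fun h0 => hΦ ((algebraMap L F).injective (h0.trans (map_zero _).symm)))
      (toExt_ne_zero hω)
  · rw [hdG]
    ext i j
    simp only [wedge_apply, Pi.smul_apply, smul_eq_mul, Pi.zero_apply]
    ring

theorem IsProjectivePair.map {E M : Type*} [Field E] [Field M] [Algebra E M]
    {δ : Fin n → Derivation ℤ E E} {D : Fin n → Derivation ℤ M M}
    (hD : ∀ i a, D i (algebraMap E M a) = algebraMap E M (δ i a)) {ω ω₁ ω₂ : Fin n → E}
    (h : IsProjectivePair δ ω ω₁ ω₂) :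
    IsProjectivePair D (fun i => algebraMap E M (ω i)) (fun i => algebraMap E M (ω₁ i))
      (fun i => algebraMap E M (ω₂ i)) := by
  refine ⟨?_, ?_, ?_⟩ <;> ext i j <;> rw [dForm_algebraMap hD]
  · rw [h.d_zero]; simp [wedge_apply]
  · rw [h.d_one]; simp [wedge_apply]
  · rw [h.d_two]; simp [wedge_apply]

/-- A solution of `dF = F η` is an integrating factor. -/
theorem exists_firstIntegral_of_isClosedMultiplier {S : StepKind n} (hS : S.IsFunctorial)
    {ω : Fin n → HolGerm n} (hω : ω ≠ 0) {L : Type} [Field L] [Algebra (MerGerm n) L]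
    {D : Fin n → Derivation ℤ L L} (h : IsExtensionOfKind S D) {η : Fin n → L}
    (hη : IsClosedMultiplier D (toExt L ω) η)
    (hSadm : ∀ (F : Type) [Field F] [Algebra (MerGerm n) F] (γ₁ γ₀ : Fin n → F),
      S.Admits 0 γ₁ γ₀) :
    ∃ (F : Type) (_ : Field F) (_ : Algebra (MerGerm n) F) (D' : Fin n → Derivation ℤ F F),
      IsDifferentialExtension D' ∧ IsTower D' (S F D') ∧ ∃ H : F, IsFirstIntegral D' ω H := by
  obtain ⟨F, _, _, _, _, D', Φ, hK, hΦ, hD', hdΦ⟩ := h.adjoin hS (γ₂ := 0) (γ₁ := η) (γ₀ := 0)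
    (by rw [dForm_zero, zero_wedge]) (by rw [hη.closed, zero_wedge])
    (by rw [dForm_zero, wedge_zero]) (hSadm L _ _)
  refine exists_firstIntegral_of_integrating_factor hS hω hK hΦ ?_ (hSadm F _ _)
  rw [dForm_smul_eq_zero_iff]
  intro i j
  have h0 := congrArg (algebraMap L F) (congrFun (congrFun hη.d_zero i) j)
  rw [← dForm_algebraMap hD'] at h0
  simp only [wedge_apply, map_sub, map_mul] at h0
  simp only [← toExt_eq_algebraMap] at h0
  change dForm D' (toExt F ω) i j = _ at h0
  rw [tangentDer_apply, hdΦ, hdΦ, h0]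
  simp only [Pi.zero_apply, map_zero, Nat.cast_one]
  ring

/-- A solution `g` of `dg = g² / 2 ω + g ω₁ + ω₂` makes the gauge transform `ω₁ + g ω` closed. -/
theorem exists_firstIntegral_of_isProjectivePair {S : StepKind n} (hS : S.IsFunctorial)
    {ω : Fin n → HolGerm n} (hω : ω ≠ 0) {L : Type} [Field L] [Algebra (MerGerm n) L]
    {D : Fin n → Derivation ℤ L L} (h : IsExtensionOfKind S D) {ω₁ ω₂ : Fin n → L}
    (hp : IsProjectivePair D (toExt L ω) ω₁ ω₂)
    (hSadm : ∀ (F : Type) [Field F] [Algebra (MerGerm n) F] (γ₂ γ₁ γ₀ : Fin n → F),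
      S.Admits γ₂ γ₁ γ₀) :
    ∃ (F : Type) (_ : Field F) (_ : Algebra (MerGerm n) F) (D' : Fin n → Derivation ℤ F F),
      IsDifferentialExtension D' ∧ IsTower D' (S F D') ∧ ∃ H : F, IsFirstIntegral D' ω H := by
  obtain ⟨F, _, _, _, _, D', g, hK, -, hD', hg⟩ := h.adjoin hS hp.d_zero hp.d_one hp.d_two
    (hSadm L _ _ _)
  have : CharZero F := charZero_of_injective_algebraMap (algebraMap (MerGerm n) F).injective
  have htoExt : (fun i => algebraMap L F (toExt L ω i)) = toExt F ω :=
    funext fun i => (toExt_eq_algebraMap ω i).symm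
  have hp' := (hp.map hD').gauge hK.isDifferentialExtension.comm g
  rw [htoExt] at hp'
  have hzero : (fun i => algebraMap L F (ω₂ i)) + g • (fun i => algebraMap L F (ω₁ i)) -
      dFun D' g + (g ^ 2 / 2) • toExt F ω = 0 := by
    ext i
    simp only [Pi.add_apply, Pi.sub_apply, Pi.smul_apply, smul_eq_mul, dFun, hg, Pi.zero_apply,
      toExt_eq_algebraMap (L := L) (F := F)]
    ring
  exact exists_firstIntegral_of_isClosedMultiplier hS hω hK
    ⟨hp'.d_zero, by rw [hp'.d_one, hzero, wedge_zero]⟩ fun F _ _ => hSadm F 0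

end Construction

theorem darbouxStep_admits {n : ℕ} {L : Type} [Field L] [Algebra (MerGerm n) L] (γ : Fin n → L) :
    StepKind.Admits (fun _ _ _ D => DarbouxStep D) 0 0 γ := by
  intro F _ _ D' ι G hG
  exact ⟨fun i => ι (γ i), fun i => ⟨γ i, rfl⟩, funext fun i => (hG i).trans (by simp)⟩

theorem liouvilleStep_admits {n : ℕ} {L : Type} [Field L] [Algebra (MerGerm n) L]
    (γ₁ γ₀ : Fin n → L) : StepKind.Admits (fun _ _ _ D => LiouvilleStep D) 0 γ₁ γ₀ := by
  intro F _ _ D' ι G hG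
  exact ⟨fun i => ι (γ₁ i), fun i => ι (γ₀ i), fun i => ⟨γ₁ i, rfl⟩, fun i => ⟨γ₀ i, rfl⟩,
    funext fun i => (hG i).trans (by simp)⟩

theorem HasGodbillonVeyOfLengthOne.hasDarbouxFirstIntegral {n : ℕ} {ω : Fin n → HolGerm n}
    (hω : ω ≠ 0) (h : HasGodbillonVeyOfLengthOne ω) : HasDarbouxFirstIntegral ω := by
  obtain ⟨F, k, hF, hk, hs⟩ := h.exists_solves
  obtain ⟨D, hext, Φ, hΦ, -, hd⟩ := exists_root_of_solves hF hk hs (AlgebraicClosure (MerGerm n))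
  refine exists_firstIntegral_of_integrating_factor (S := fun _ _ _ D => DarbouxStep D)
    isFunctorial_darboux hω (isExtensionOfKind_of_isAlgebraic _ hext) hΦ hd
    (darbouxStep_admits _)

theorem HasGodbillonVeyOfLength.hasLiouvilleFirstIntegral {n : ℕ} {ω : Fin n → HolGerm n}
    (hω : ω ≠ 0) (h : HasGodbillonVeyOfLength ω 2) : HasLiouvilleFirstIntegral ω := by
  obtain ⟨η, hη⟩ := hasGodbillonVeyOfLength_two_iff.1 h
  refine exists_firstIntegral_of_isClosedMultiplier (S := fun _ _ _ D => LiouvilleStep D)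
    isFunctorial_liouville hω (isExtensionOfKind_merPartial _) hη
    fun _ _ _ => liouvilleStep_admits

theorem riccatiStep_admits {n : ℕ} {L : Type} [Field L] [Algebra (MerGerm n) L]
    (γ₂ γ₁ γ₀ : Fin n → L) :
    StepKind.Admits (fun _ _ _ D => RiccatiStep D) γ₂ γ₁ γ₀ := by
  intro F _ _ D' ι G hG
  exact ⟨_, _, _, fun i => ⟨γ₂ i, rfl⟩, fun i => ⟨γ₁ i, rfl⟩, fun i => ⟨γ₀ i, rfl⟩,
    funext fun i => hG i⟩

theorem HasGodbillonVeyOfLength.hasRiccatiFirstIntegral {n : ℕ} {ω : Fin n → HolGerm n}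
    (hω : ω ≠ 0) (h : HasGodbillonVeyOfLength ω 3) : HasRiccatiFirstIntegral ω := by
  obtain ⟨ω₁, ω₂, hp⟩ := hasGodbillonVeyOfLength_three_iff.1 h
  exact exists_firstIntegral_of_isProjectivePair (S := fun _ _ _ D => RiccatiStep D)
    isFunctorial_riccati hω (isExtensionOfKind_merPartial _) hp fun _ _ _ => riccatiStep_admits

end GVFoliation

end

theorem mainTheorem5 {n : ℕ} (ω : Fin n → GVFoliation.HolGerm n) (hω : ω ≠ 0)
    (hint : GVFoliation.IsIntegrable ω) :
    (GVFoliation.HasDarbouxFirstIntegral ω ↔ GVFoliation.HasGodbillonVeyOfLengthOne ω) ∧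
    (GVFoliation.HasLiouvilleFirstIntegral ω ↔ GVFoliation.HasGodbillonVeyOfLength ω 2) ∧
    (GVFoliation.HasRiccatiFirstIntegral ω ↔ GVFoliation.HasGodbillonVeyOfLength ω 3) :=
  ⟨⟨fun h => h.hasGodbillonVeyOfLengthOne hω, fun h => h.hasDarbouxFirstIntegral hω⟩,
    ⟨fun h => h.hasGodbillonVeyOfLength hω hint, fun h => h.hasLiouvilleFirstIntegral hω⟩,
    ⟨fun h => h.hasGodbillonVeyOfLength hω hint, fun h => h.hasRiccatiFirstIntegral hω⟩⟩
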